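/- Let $N\ge 2$, $s\in(0,1)$, let $\Omega\subset\mathbb R^N$ be a bounded open set, and let $p\in C(\mathbb R^N\times\mathbb R^N)$ be symmetric, $p(x,y)=p(y,x)$, with $$1<p^-:=\inf_{\mathbb R^N\times\mathbb R^N}p\le \sup_{\mathbb R^N\times\mathbb R^N}p=:p^+<\frac Ns .$$ Let $\mathscr W$ be the space of (classes modulo a.e. equality of) measurable functions $u:\mathbb R^N\to\mathbb R$ with $u=0$ a.e. in $\mathbb R^N\setminus\Omega$ such that, for some $\zeta>0$, $$\int_{\mathbb R^N}\Big|\frac{u(x)}{\zeta}\Big|^{p(x,x)}dx<\infty \quad\text{and, for some } \zeta>0,\quad \iint_{\mathbb R^N\times\mathbb R^N}\frac{|u(x)-u(y)|^{p(x,y)}}{\zeta^{p(x,y)}|x-y|^{N+sp(x,y)}}\,dx\,dy<\infty ,$$ normed by $$\|u\|_{\mathscr W}=\inf\Big\{\zeta>0:\iint_{\mathbb R^N\times\mathbb R^N}\frac{|u(x)-u(y)|^{p(x,y)}}{\zeta^{p(x,y)}|x-y|^{N+sp(x,y)}}\,dx\,dy\le1\Big\}.$$ Let $A:\mathbb R^N\times\mathbb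 R^N\times\mathbb R\to\mathbb R$ be measurable (the case in which $A(x,y,t)=A(t)$ does not depend on $(x,y)$ is included), put $\mathcal A(x,y,t)=\int_0^{|t|}A(x,y,\tau)\,d\tau$, and assume that - for all $(x,y)$, $A(x,y,\cdot)$ is continuous and odd and $\mathcal A(x,y,\cdot)$ is strictly convex on $\mathbb R$; - there are constants $c,C>0$ with $A(x,y,t)\,t\ge c|t|^{p(x,y)}$ and $|A(x,y,t)|\le C|t|^{p(x,y)-1}$ for all $x,y,t$; - $A(x,y,t)\,t\le p^+\mathcal A(x,y,t)$ for all $x,y,t$. Let $K:\mathbb R^N\times\mathbb R^N\to[0,\infty)$ be measurable, and assume there are constants $0<b_0\le b_1$ with $b_0\le K(x,y)|x-y|^{N+sp(x,y)}\le b_1$ for all $x\ne y$. Then the functional $$\Phi(u)=\iint_{\mathbb R^N\times\mathbb R^N}\mathcal A\big(x,y,u(x)-u(y)\big)K(x,y)\,dx\,dy$$ has the following properties. 1. $\Phi$ is well defined on $\mathscr W$ (the integrand is integrable for every $u\in\mathscr W$), it is of class $C^1(\mathscr W,\mathbb R)$, and for all $u,v\in\mathscr W$ $$\langle\Phi'(u),v\rangle=\iint_{\mathbb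 R^N\times\mathbb R^N}A\big(x,y,u(x)-u(y)\big)\big(v(x)-v(y)\big)K(x,y)\,dx\,dy,$$ where the integrand is integrable. 2. $\Phi$ is weakly lower semicontinuous: if $u_k\rightharpoonup u$ in $\mathscr W$, then $\Phi(u)\le\liminf_{k\to\infty}\Phi(u_k)$. 3. $\Phi'$ is of type $(S_+)$: if $u_k\rightharpoonup u$ in $\mathscr W$ and $\limsup_{k\to\infty}\langle\Phi'(u_k),u_k-u\rangle\le0$, then $u_k\to u$ in $\mathscr W$. -/

import Mathlib

open MeasureTheory Filter Topology
open scoped ENNReal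

noncomputable section

namespace FracVar

/-! ### Convex modulars on a real vector space -/

/-- An even convex functional with values in `[0, ∞]` that vanishes at the origin. -/
structure IsConvexModular {V : Type*} [AddCommGroup V] [Module ℝ V] (ρ : V → ℝ≥0∞) : Prop where
  zero : ρ 0 = 0
  neg : ∀ v, ρ (-v) = ρ v
  convex : ∀ (v w : V) (a b : ℝ), 0 ≤ a → 0 ≤ b → a + b = 1 →
    ρ (a • v + b • w) ≤ ENNReal.ofReal a * ρ v + ENNReal.ofReal b * ρ w

namespace IsConvexModular

variable {V : Type*} [AddCommGroup V] [Module ℝ V] {ρ : V → ℝ≥0∞}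

theorem smul_le (h : IsConvexModular ρ) (v : V) {a : ℝ} (h0 : 0 ≤ a) (h1 : a ≤ 1) :
    ρ (a • v) ≤ ENNReal.ofReal a * ρ v := by
  have := h.convex v 0 a (1 - a) h0 (by linarith) (by ring)
  simpa [h.zero] using this

theorem add_le (h : IsConvexModular ρ) (v w : V) {ζ η : ℝ} (hζ : 0 < ζ) (hη : 0 < η) :
    ρ ((ζ + η)⁻¹ • (v + w)) ≤ ENNReal.ofReal (ζ / (ζ + η)) * ρ (ζ⁻¹ • v)
      + ENNReal.ofReal (η / (ζ + η)) * ρ (η⁻¹ • w) := by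
  have hs : 0 < ζ + η := by positivity
  have := h.convex (ζ⁻¹ • v) (η⁻¹ • w) (ζ / (ζ + η)) (η / (ζ + η)) (by positivity)
    (by positivity) (by field_simp)
  convert this using 2
  rw [smul_smul, smul_smul, smul_add]
  congr 2 <;> field_simp

theorem smul_abs (h : IsConvexModular ρ) (c : ℝ) (v : V) : ρ (c • v) = ρ (|c| • v) := by
  rcases abs_choice c with hc | hc
  · rw [hc]
  · rw [hc, neg_smul, h.neg]

theorem finite_add (h : IsConvexModular ρ) {v w : V} (hv : ∃ ζ : ℝ, 0 < ζ ∧ ρ (ζ⁻¹ • v) < ∞)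
    (hw : ∃ ζ : ℝ, 0 < ζ ∧ ρ (ζ⁻¹ • w) < ∞) : ∃ ζ : ℝ, 0 < ζ ∧ ρ (ζ⁻¹ • (v + w)) < ∞ := by
  obtain ⟨ζ, hζ, h1⟩ := hv
  obtain ⟨η, hη, h2⟩ := hw
  refine ⟨ζ + η, by positivity, (h.add_le v w hζ hη).trans_lt ?_⟩
  exact ENNReal.add_lt_top.2 ⟨ENNReal.mul_lt_top ENNReal.ofReal_lt_top h1,
    ENNReal.mul_lt_top ENNReal.ofReal_lt_top h2⟩

theorem finite_smul (h : IsConvexModular ρ) {v : V} (c : ℝ)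
    (hv : ∃ ζ : ℝ, 0 < ζ ∧ ρ (ζ⁻¹ • v) < ∞) : ∃ ζ : ℝ, 0 < ζ ∧ ρ (ζ⁻¹ • (c • v)) < ∞ := by
  obtain ⟨ζ, hζ, h1⟩ := hv
  rcases eq_or_ne c 0 with rfl | hc
  · exact ⟨1, one_pos, by simp [h.zero]⟩
  · have hc' : 0 < |c| := abs_pos.2 hc
    refine ⟨|c| * ζ, by positivity, ?_⟩
    rw [smul_smul, h.smul_abs, abs_mul, abs_inv, abs_mul, abs_abs, abs_of_pos hζ]
    have : (|c| * ζ)⁻¹ * |c| = ζ⁻¹ := by field_simp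
    rwa [this]

/-- The Luxemburg functional of a modular. -/
def lux (ρ : V → ℝ≥0∞) (v : V) : ℝ := sInf {ζ : ℝ | 0 < ζ ∧ ρ (ζ⁻¹ • v) ≤ 1}

theorem lux_nonneg (v : V) : 0 ≤ lux ρ v := Real.sInf_nonneg fun _ h => h.1.le

theorem lux_le {v : V} {ζ : ℝ} (hζ : 0 < ζ) (h : ρ (ζ⁻¹ • v) ≤ 1) : lux ρ v ≤ ζ :=
  csInf_le ⟨0, fun _ h => h.1.le⟩ ⟨hζ, h⟩

theorem exists_le_one (h : IsConvexModular ρ) {v : V}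
    (hv : ∃ ζ : ℝ, 0 < ζ ∧ ρ (ζ⁻¹ • v) < ∞) : {ζ : ℝ | 0 < ζ ∧ ρ (ζ⁻¹ • v) ≤ 1}.Nonempty := by
  obtain ⟨ζ, hζ, h1⟩ := hv
  set r := (ρ (ζ⁻¹ • v)).toReal with hr
  have hr0 : 0 ≤ r := ENNReal.toReal_nonneg
  refine ⟨(1 + r) * ζ, by positivity, ?_⟩
  have h2 := h.smul_le (ζ⁻¹ • v) (a := (1 + r)⁻¹) (by positivity)
    (inv_le_one_of_one_le₀ (by linarith))
  rw [smul_smul, ← mul_inv] at h2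
  refine h2.trans ?_
  rw [← ENNReal.ofReal_toReal h1.ne, ← hr, ← ENNReal.ofReal_mul (by positivity)]
  refine ENNReal.ofReal_le_one.2 ?_
  rw [inv_mul_le_iff₀ (by positivity)]
  linarith

theorem lux_smul_le (h : IsConvexModular ρ) {v : V} (c : ℝ)
    (hv : ∃ ζ : ℝ, 0 < ζ ∧ ρ (ζ⁻¹ • v) < ∞) : lux ρ (c • v) ≤ |c| * lux ρ v := by
  rcases eq_or_ne c 0 with rfl | hc
  · simp only [zero_smul, abs_zero, zero_mul]
    refine le_of_forall_pos_le_add fun ε hε => ?_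
    rw [zero_add]
    exact lux_le hε (by simp [h.zero])
  · have hc' : 0 < |c| := abs_pos.2 hc
    rw [← div_le_iff₀' hc']
    refine le_csInf (h.exists_le_one hv) fun ζ hζ => ?_
    rw [div_le_iff₀' hc']
    refine lux_le (mul_pos hc' hζ.1) ?_
    rw [smul_smul, h.smul_abs, abs_mul, abs_inv, abs_mul, abs_abs, abs_of_pos hζ.1]
    have : (|c| * ζ)⁻¹ * |c| = ζ⁻¹ := by have := hζ.1.ne'; field_simp
    rw [this]
    exact hζ.2

theorem lux_smul (h : IsConvexModular ρ) {v : V} (c : ℝ)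
    (hv : ∃ ζ : ℝ, 0 < ζ ∧ ρ (ζ⁻¹ • v) < ∞) : lux ρ (c • v) = |c| * lux ρ v := by
  refine le_antisymm (h.lux_smul_le c hv) ?_
  rcases eq_or_ne c 0 with rfl | hc
  · simpa using lux_nonneg _
  · have hc' : 0 < |c| := abs_pos.2 hc
    have h1 := h.lux_smul_le c⁻¹ (h.finite_smul c hv)
    rw [smul_smul, inv_mul_cancel₀ hc, one_smul, abs_inv, ← div_eq_inv_mul,
      le_div_iff₀' hc'] at h1
    exact h1

theorem lux_add (h : IsConvexModular ρ) {v w : V} (hv : ∃ ζ : ℝ, 0 < ζ ∧ ρ (ζ⁻¹ • v) < ∞)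
    (hw : ∃ ζ : ℝ, 0 < ζ ∧ ρ (ζ⁻¹ • w) < ∞) : lux ρ (v + w) ≤ lux ρ v + lux ρ w := by
  have key : ∀ ζ ∈ {ζ : ℝ | 0 < ζ ∧ ρ (ζ⁻¹ • v) ≤ 1}, ∀ η ∈ {ζ : ℝ | 0 < ζ ∧ ρ (ζ⁻¹ • w) ≤ 1},
      lux ρ (v + w) ≤ ζ + η := by
    rintro ζ ⟨hζ, h1⟩ η ⟨hη, h2⟩
    refine lux_le (by positivity) ((h.add_le v w hζ hη).trans ?_)
    calc _ ≤ ENNReal.ofReal (ζ / (ζ + η)) * 1 + ENNReal.ofReal (η / (ζ + η)) * 1 := by gcongr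
      _ = 1 := by
        rw [mul_one, mul_one, ← ENNReal.ofReal_add (by positivity) (by positivity), ← add_div,
          div_self (by positivity), ENNReal.ofReal_one]
  have h1 : ∀ ζ ∈ {ζ : ℝ | 0 < ζ ∧ ρ (ζ⁻¹ • v) ≤ 1}, lux ρ (v + w) - ζ ≤ lux ρ w := fun ζ hζ =>
    le_csInf (h.exists_le_one hw) fun η hη => by linarith [key ζ hζ η hη]
  have h2 : lux ρ (v + w) - lux ρ w ≤ lux ρ v :=
    le_csInf (h.exists_le_one hv) fun ζ hζ => by linarith [h1 ζ hζ]
  linarith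

theorem eq_zero_of_lux (h : IsConvexModular ρ) {v : V}
    (hv : ∃ ζ : ℝ, 0 < ζ ∧ ρ (ζ⁻¹ • v) < ∞) (h0 : lux ρ v = 0) : ρ v = 0 := by
  refine le_antisymm (ENNReal.le_of_forall_pos_le_add fun ε hε _ => ?_) bot_le
  rw [zero_add]
  have hm : (0 : ℝ) < min ε 1 := lt_min (by exact_mod_cast hε) one_pos
  obtain ⟨ζ, ⟨hζ, h1⟩, h2⟩ := exists_lt_of_csInf_lt (h.exists_le_one hv) (h0.trans_lt hm)
  have h3 := h.smul_le (ζ⁻¹ • v) hζ.le (h2.le.trans (min_le_right _ _))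
  rw [smul_smul, mul_inv_cancel₀ hζ.ne', one_smul] at h3
  calc ρ v ≤ ENNReal.ofReal ζ * 1 := h3.trans (by gcongr)
    _ ≤ ENNReal.ofReal ε := by
      rw [mul_one]; exact ENNReal.ofReal_le_ofReal (h2.le.trans (min_le_left _ _))
    _ = ε := ENNReal.ofReal_coe_nnreal

end IsConvexModular

/-! ### Exponents, domain and modulars -/

/-- `ℝ^N` with its Euclidean norm. -/
abbrev Eu (N : ℕ) : Type := EuclideanSpace ℝ (Fin N)

/-- `p⁻`, the infimum of the exponent over `ℝ^N × ℝ^N`. -/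
def expInf {N : ℕ} (p : Eu N × Eu N → ℝ) : ℝ := ⨅ z, p z

/-- `p⁺`, the supremum of the exponent over `ℝ^N × ℝ^N`. -/
def expSup {N : ℕ} (p : Eu N × Eu N → ℝ) : ℝ := ⨆ z, p z

/-- The standing assumptions on the dimension, the order `s`, the variable exponent `p` and the
set `Ω`. No regularity or connectedness of `Ω` is asked for. -/
structure Standing (N : ℕ) (s : ℝ) (p : Eu N × Eu N → ℝ) (Ω : Set (Eu N)) : Prop where
  two_le : 2 ≤ N
  s_pos : 0 < s
  s_lt_one : s < 1
  cont : Continuous p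
  symm : ∀ x y, p (x, y) = p (y, x)
  bddAbove : BddAbove (Set.range p)
  one_lt_inf : 1 < expInf p
  sup_lt : expSup p < N / s
  isOpen : IsOpen Ω
  bounded : Bornology.IsBounded Ω

/-- The modular `∫ |f(x)|^{p(x,x)} dx` of `L^{p(·)}(ℝ^N)`. -/
def lebModular {N : ℕ} (p : Eu N × Eu N → ℝ) (f : Eu N → ℝ) : ℝ≥0∞ :=
  ∫⁻ x, ENNReal.ofReal (|f x| ^ p (x, x))

/-- The Gagliardo modular `∬ |f(x) - f(y)|^{p(x,y)} / |x - y|^{N + s p(x,y)} dx dy`. -/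
def gagModular {N : ℕ} (s : ℝ) (p : Eu N × Eu N → ℝ) (f : Eu N → ℝ) : ℝ≥0∞ :=
  ∫⁻ z : Eu N × Eu N,
    ENNReal.ofReal (|f z.1 - f z.2| ^ p z / ‖z.1 - z.2‖ ^ ((N : ℝ) + s * p z))

/-- The Gagliardo seminorm `[f]^{s,p(·,·)}` on `ℝ^N` (of Luxemburg type). -/
def gagNorm {N : ℕ} (s : ℝ) (p : Eu N × Eu N → ℝ) (f : Eu N → ℝ) : ℝ :=
  sInf {ζ : ℝ | 0 < ζ ∧ gagModular s p (fun x => f x / ζ) ≤ 1}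

/-- Membership in `W`: `f ∈ L^{p(·)}(ℝ^N)`, the Gagliardo modular of `f / ζ` is finite for some
`ζ > 0`, and `f = 0` almost everywhere outside `Ω`. -/
def MemW {N : ℕ} (s : ℝ) (p : Eu N × Eu N → ℝ) (Ω : Set (Eu N)) (f : Eu N → ℝ) : Prop :=
  (∃ ζ : ℝ, 0 < ζ ∧ lebModular p (fun x => f x / ζ) < ∞) ∧
  (∃ ζ : ℝ, 0 < ζ ∧ gagModular s p (fun x => f x / ζ) < ∞) ∧
  ∀ᵐ x, x ∉ Ω → f x = 0

section helpers

variable {N : ℕ} {s : ℝ} {p : Eu N × Eu N → ℝ} {Ω : Set (Eu N)}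

theorem Standing.one_lt (h : Standing N s p Ω) (z : Eu N × Eu N) : 1 < p z := by
  have hb : BddBelow (Set.range p) := by
    by_contra hb
    have h0 : expInf p = 0 := Real.sInf_of_not_bddBelow hb
    linarith [h.one_lt_inf]
  exact h.one_lt_inf.trans_le (ciInf_le hb z)

theorem abs_rpow_convex {q : ℝ} (hq : 1 ≤ q) (x y a b : ℝ) (ha : 0 ≤ a) (hb : 0 ≤ b)
    (hab : a + b = 1) : |a * x + b * y| ^ q ≤ a * |x| ^ q + b * |y| ^ q := by
  have h1 : |a * x + b * y| ≤ a * |x| + b * |y| := by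
    refine (abs_add_le _ _).trans ?_
    rw [abs_mul, abs_mul, abs_of_nonneg ha, abs_of_nonneg hb]
  refine (Real.rpow_le_rpow (abs_nonneg _) h1 (by linarith)).trans ?_
  have := (convexOn_rpow hq).2 (abs_nonneg x) (abs_nonneg y) ha hb hab
  simpa using this

theorem lebModular_congr {f g : Eu N → ℝ} (h : f =ᵐ[volume] g) :
    lebModular p f = lebModular p g :=
  lintegral_congr_ae (h.mono fun x hx => by simp only [hx])

theorem ae_fst_snd {P : Eu N → Prop} (h : ∀ᵐ x, P x) :
    ∀ᵐ z : Eu N × Eu N, P z.1 ∧ P z.2 :=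
  (Measure.quasiMeasurePreserving_fst.ae h).and (Measure.quasiMeasurePreserving_snd.ae h)

theorem gagModular_congr {f g : Eu N → ℝ} (h : f =ᵐ[volume] g) :
    gagModular s p f = gagModular s p g :=
  lintegral_congr_ae ((ae_fst_snd h).mono fun z hz => by simp only [hz.1, hz.2])

theorem coe_inv_smul (ζ : ℝ) (u : Eu N →ₘ[volume] ℝ) :
    ⇑(ζ⁻¹ • u) =ᵐ[volume] fun x => u x / ζ := by
  filter_upwards [AEEqFun.coeFn_smul ζ⁻¹ u] with x hx
  rw [hx, Pi.smul_apply, smul_eq_mul, div_eq_inv_mul]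

theorem coe_comb (a b : ℝ) (u v : Eu N →ₘ[volume] ℝ) :
    ⇑(a • u + b • v) =ᵐ[volume] fun x => a * u x + b * v x := by
  filter_upwards [AEEqFun.coeFn_add (a • u) (b • v), AEEqFun.coeFn_smul a u,
    AEEqFun.coeFn_smul b v] with x h1 h2 h3
  simp [h1, h2, h3]

theorem lebModular_isConvexModular (h : Standing N s p Ω) :
    IsConvexModular fun u : Eu N →ₘ[volume] ℝ => lebModular p u where
  zero := by
    rw [lebModular_congr AEEqFun.coeFn_zero]
    simp [lebModular, fun x => Real.zero_rpow (one_pos.trans (h.one_lt x)).ne']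
  neg u := by
    rw [lebModular_congr (AEEqFun.coeFn_neg u)]
    simp [lebModular]
  convex u v a b ha hb hab := by
    have hp : Measurable fun x : Eu N => p (x, x) :=
      (h.cont.comp (continuous_id.prodMk continuous_id)).measurable
    have hu : Measurable u := u.stronglyMeasurable.measurable
    rw [lebModular_congr (coe_comb a b u v)]
    unfold lebModular
    rw [← lintegral_const_mul' _ _ ENNReal.ofReal_ne_top,
      ← lintegral_const_mul' _ _ ENNReal.ofReal_ne_top, ← lintegral_add_left (((hu.abs.pow hp).ennreal_ofReal).const_mul _)]
    refine lintegral_mono fun x => ?_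
    rw [← ENNReal.ofReal_mul ha, ← ENNReal.ofReal_mul hb,
      ← ENNReal.ofReal_add (by positivity) (by positivity)]
    exact ENNReal.ofReal_le_ofReal (abs_rpow_convex (h.one_lt _).le _ _ a b ha hb hab)

theorem gagModular_isConvexModular (h : Standing N s p Ω) :
    IsConvexModular fun u : Eu N →ₘ[volume] ℝ => gagModular s p u where
  zero := by
    rw [gagModular_congr AEEqFun.coeFn_zero]
    simp [gagModular, fun x => Real.zero_rpow (one_pos.trans (h.one_lt x)).ne']
  neg u := by
    rw [gagModular_congr (AEEqFun.coeFn_neg u)]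
    unfold gagModular
    refine lintegral_congr fun z => ?_
    rw [Pi.neg_apply, Pi.neg_apply, neg_sub_neg, abs_sub_comm]
  convex u v a b ha hb hab := by
    have hp : Measurable p := h.cont.measurable
    have hu : Measurable u := u.stronglyMeasurable.measurable
    rw [gagModular_congr (coe_comb a b u v)]
    unfold gagModular
    rw [← lintegral_const_mul' _ _ ENNReal.ofReal_ne_top,
      ← lintegral_const_mul' _ _ ENNReal.ofReal_ne_top, ← lintegral_add_left (by fun_prop)]
    refine lintegral_mono fun z => ?_
    rw [← ENNReal.ofReal_mul ha, ← ENNReal.ofReal_mul hb,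
      ← ENNReal.ofReal_add (by positivity) (by positivity)]
    refine ENNReal.ofReal_le_ofReal ?_
    have h1 := abs_rpow_convex (h.one_lt z).le (u z.1 - u z.2) (v z.1 - v z.2) a b ha hb hab
    rw [← mul_div_assoc, ← mul_div_assoc, ← add_div]
    refine div_le_div_of_nonneg_right ?_ (by positivity)
    have h2 : a * (u z.1 - u z.2) + b * (v z.1 - v z.2) =
        a * u z.1 + b * v z.1 - (a * u z.2 + b * v z.2) := by ring
    rw [h2] at h1
    exact h1

theorem gagNorm_eq_lux (u : Eu N →ₘ[volume] ℝ) :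
    gagNorm s p u =
      IsConvexModular.lux (fun u : Eu N →ₘ[volume] ℝ => gagModular s p u) u := by
  unfold gagNorm IsConvexModular.lux
  simp only [gagModular_congr (coe_inv_smul _ u)]

theorem MemW.leb {u : Eu N →ₘ[volume] ℝ} (h : MemW s p Ω u) :
    ∃ ζ : ℝ, 0 < ζ ∧ (fun u : Eu N →ₘ[volume] ℝ => lebModular p u) (ζ⁻¹ • u) < ∞ := by
  simpa only [lebModular_congr (coe_inv_smul _ u)] using h.1

theorem MemW.gag {u : Eu N →ₘ[volume] ℝ} (h : MemW s p Ω u) :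
    ∃ ζ : ℝ, 0 < ζ ∧ (fun u : Eu N →ₘ[volume] ℝ => gagModular s p u) (ζ⁻¹ • u) < ∞ := by
  simpa only [gagModular_congr (coe_inv_smul _ u)] using h.2.1

theorem memW_of {u : Eu N →ₘ[volume] ℝ}
    (h1 : ∃ ζ : ℝ, 0 < ζ ∧ (fun u : Eu N →ₘ[volume] ℝ => lebModular p u) (ζ⁻¹ • u) < ∞)
    (h2 : ∃ ζ : ℝ, 0 < ζ ∧ (fun u : Eu N →ₘ[volume] ℝ => gagModular s p u) (ζ⁻¹ • u) < ∞)
    (h3 : ∀ᵐ x, x ∉ Ω → u x = 0) : MemW s p Ω u := by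
  refine ⟨?_, ?_, h3⟩
  · simpa only [lebModular_congr (coe_inv_smul _ u)] using h1
  · simpa only [gagModular_congr (coe_inv_smul _ u)] using h2

end helpers

/-! ### The space `W` -/

/-- `W` as a linear subspace of the space of classes, modulo equality almost everywhere, of
measurable functions on `ℝ^N`. -/
def subW {N : ℕ} {s : ℝ} {p : Eu N × Eu N → ℝ} {Ω : Set (Eu N)} (h : Standing N s p Ω) :
    Submodule ℝ (Eu N →ₘ[(volume : Measure (Eu N))] ℝ) where
  carrier := {u | MemW s p Ω u}
  zero_mem' := by
    refine memW_of ⟨1, one_pos, ?_⟩ ⟨1, one_pos, ?_⟩ ?_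
    · rw [smul_zero]; refine (lebModular_isConvexModular h).zero.trans_lt ?_; exact ENNReal.zero_lt_top
    · rw [smul_zero]; refine (gagModular_isConvexModular h).zero.trans_lt ?_; exact ENNReal.zero_lt_top
    · filter_upwards [AEEqFun.coeFn_zero (μ := (volume : Measure (Eu N))) (β := ℝ)] with x hx _
      exact hx
  add_mem' := by
    intro u v hu hv
    refine memW_of ((lebModular_isConvexModular h).finite_add hu.leb hv.leb)
      ((gagModular_isConvexModular h).finite_add hu.gag hv.gag) ?_
    filter_upwards [AEEqFun.coeFn_add u v, hu.2.2, hv.2.2] with x h1 h2 h3 hx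
    rw [h1, Pi.add_apply, h2 hx, h3 hx, add_zero]
  smul_mem' := by
    intro c u hu
    refine memW_of ((lebModular_isConvexModular h).finite_smul c hu.leb)
      ((gagModular_isConvexModular h).finite_smul c hu.gag) ?_
    filter_upwards [AEEqFun.coeFn_smul c u, hu.2.2] with x h1 h2 hx
    rw [h1, Pi.smul_apply, h2 hx, smul_zero]

/-- The space `W = W_0^{s,p(·,·)}`. -/
def W {N : ℕ} {s : ℝ} {p : Eu N × Eu N → ℝ} {Ω : Set (Eu N)} (h : Standing N s p Ω) : Type :=
  subW h

namespace W

variable {N : ℕ} {s : ℝ} {p : Eu N × Eu N → ℝ} {Ω : Set (Eu N)} {h : Standing N s p Ω}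

instance : AddCommGroup (W h) := inferInstanceAs (AddCommGroup (subW h))

instance : Module ℝ (W h) := inferInstanceAs (Module ℝ (subW h))

/-- The class modulo equality almost everywhere underlying an element of `W`. -/
def toClass (u : W h) : Eu N →ₘ[(volume : Measure (Eu N))] ℝ := Subtype.val u

/-- A measurable representative of an element of `W`. -/
instance : CoeFun (W h) fun _ => Eu N → ℝ := ⟨fun u => u.toClass⟩

theorem memW (u : W h) : MemW s p Ω u := Subtype.property u

/-- `‖u‖_W` is the Gagliardo seminorm of `u` on `ℝ^N`. -/
instance : Norm (W h) := ⟨fun u => gagNorm s p u⟩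

theorem norm_def (u : W h) : ‖u‖ = gagNorm s p u := rfl

theorem norm_eq_lux (u : W h) :
    ‖u‖ = IsConvexModular.lux (fun u : Eu N →ₘ[volume] ℝ => gagModular s p u) u.toClass :=
  gagNorm_eq_lux _

theorem eq_zero_of_norm {u : W h} (hu : ‖u‖ = 0) : u = 0 := by
  rw [norm_eq_lux] at hu
  have h0 : gagModular s p u = 0 :=
    (gagModular_isConvexModular h).eq_zero_of_lux u.memW.gag hu
  have hp : Measurable p := h.cont.measurable
  have hm : Measurable u := u.toClass.stronglyMeasurable.measurable
  have hN : 0 < N := by have := h.two_le; omega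
  have : Nonempty (Fin N) := ⟨⟨0, hN⟩⟩
  have : Nontrivial (Eu N) := inferInstance
  unfold gagModular at h0
  rw [lintegral_eq_zero_iff (by fun_prop)] at h0
  have h1 : ∀ᵐ z : Eu N × Eu N, u z.1 = u z.2 := by
    filter_upwards [h0] with z hz
    simp only [Pi.zero_apply, ENNReal.ofReal_eq_zero] at hz
    by_contra hne
    have hz12 : z.1 ≠ z.2 := fun h => hne (by rw [h])
    have h2 : 0 < |u z.1 - u z.2| := abs_pos.2 (sub_ne_zero.2 hne)
    have h3 : 0 < ‖z.1 - z.2‖ := norm_pos_iff.2 (sub_ne_zero.2 hz12)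
    have : 0 < |u z.1 - u z.2| ^ p z / ‖z.1 - z.2‖ ^ ((N : ℝ) + s * p z) := by positivity
    linarith
  have h2 : ∀ᵐ x : Eu N, ∀ᵐ y : Eu N, u x = u y := Measure.ae_ae_of_ae_prod h1
  have hΩ : volume Ωᶜ ≠ 0 := by
    intro hc
    have hfin : volume Ω < ∞ := h.bounded.measure_lt_top
    have hle : volume (Set.univ : Set (Eu N)) ≤ volume Ω + volume Ωᶜ := by
      rw [← Set.union_compl_self Ω]; exact measure_union_le _ _
    rw [hc, add_zero] at hle
    have huniv : volume (Set.univ : Set (Eu N)) = ∞ := measure_univ_of_isAddLeftInvariant _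
    rw [huniv] at hle
    exact absurd hfin (not_lt.2 hle)
  have h3 : ∀ᵐ x : Eu N, u x = 0 := by
    filter_upwards [h2] with x hx
    have h4 : ∀ᵐ y : Eu N, y ∉ Ω → u x = 0 := by
      filter_upwards [hx, u.memW.2.2] with y hy hy' hyΩ
      rw [hy, hy' hyΩ]
    by_contra hne
    exact hΩ (measure_mono_null (fun y hy => by simpa [hne] using hy) (ae_iff.1 h4))
  refine Subtype.ext (AEEqFun.ext ?_)
  filter_upwards [h3, AEEqFun.coeFn_zero (μ := (volume : Measure (Eu N))) (β := ℝ)] with x hx hx'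
  exact hx.trans hx'.symm

theorem core : NormedSpace.Core ℝ (W h) where
  norm_nonneg u := by rw [norm_eq_lux]; exact IsConvexModular.lux_nonneg _
  norm_smul c u := by
    rw [norm_eq_lux, norm_eq_lux, Real.norm_eq_abs]
    exact (gagModular_isConvexModular h).lux_smul c u.memW.gag
  norm_triangle u v := by
    rw [norm_eq_lux, norm_eq_lux, norm_eq_lux]
    exact (gagModular_isConvexModular h).lux_add u.memW.gag v.memW.gag
  norm_eq_zero_iff u := by
    refine ⟨eq_zero_of_norm, ?_⟩
    rintro rfl
    rw [norm_eq_lux]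
    have := (gagModular_isConvexModular h).lux_smul 0 (0 : W h).memW.gag
    rw [zero_smul, abs_zero, zero_mul] at this
    exact this

instance : NormedAddCommGroup (W h) := NormedAddCommGroup.ofCore core

instance : NormedSpace ℝ (W h) := NormedSpace.ofCore core

end W

/-! ### The nonlinearity, the kernel and the functional -/

/-- The primitive `t ↦ ∫₀^{|t|} A(z, τ) dτ`, where `z = (x, y)`. -/
def primA {N : ℕ} (A : Eu N × Eu N → ℝ → ℝ) (z : Eu N × Eu N) (t : ℝ) : ℝ :=
  ∫ τ in (0 : ℝ)..|t|, A z τ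

/-- The hypotheses on the nonlinearity `A(x, y, t)`. A nonlinearity `A(t)` that does not depend on
the point `(x, y)` is the case of a constant function of `z`. -/
structure NonlinearityCond {N : ℕ} (p : Eu N × Eu N → ℝ) (A : Eu N × Eu N → ℝ → ℝ) : Prop where
  measurable : Measurable (Function.uncurry A)
  continuous : ∀ z, Continuous (A z)
  odd : ∀ z t, A z (-t) = -A z t
  strictConvex : ∀ z, StrictConvexOn ℝ Set.univ (primA A z)
  growth : ∃ c C : ℝ, 0 < c ∧ 0 < C ∧ ∀ z t,
    c * |t| ^ p z ≤ A z t * t ∧ |A z t| ≤ C * |t| ^ (p z - 1)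
  le_primitive : ∀ z t, A z t * t ≤ expSup p * primA A z t

/-- The hypotheses on the kernel `K`. -/
structure KernelCond {N : ℕ} (s : ℝ) (p : Eu N × Eu N → ℝ) (K : Eu N × Eu N → ℝ) : Prop where
  measurable : Measurable K
  nonneg : ∀ z, 0 ≤ K z
  bounds : ∃ b₀ b₁ : ℝ, 0 < b₀ ∧ b₀ ≤ b₁ ∧ ∀ x y : Eu N, x ≠ y →
    b₀ ≤ K (x, y) * ‖x - y‖ ^ ((N : ℝ) + s * p (x, y)) ∧
      K (x, y) * ‖x - y‖ ^ ((N : ℝ) + s * p (x, y)) ≤ b₁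

/-- The functional `Φ(u) = ∬ 𝒜(x, y, u(x) - u(y)) K(x, y) dx dy` on `W`, where `𝒜` is the
primitive of `A`. -/
def Phi {N : ℕ} {s : ℝ} {p : Eu N × Eu N → ℝ} {Ω : Set (Eu N)} (h : Standing N s p Ω)
    (A : Eu N × Eu N → ℝ → ℝ) (K : Eu N × Eu N → ℝ) (u : W h) : ℝ :=
  ∫ z : Eu N × Eu N, primA A z (u z.1 - u z.2) * K z

/-- Weak convergence `u_k ⇀ v` of a sequence in a normed space. -/
def WeakTendsto {V : Type*} [NormedAddCommGroup V] [NormedSpace ℝ V] (u : ℕ → V) (v : V) : Prop :=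
  ∀ f : StrongDual ℝ V, Tendsto (fun k => f (u k)) atTop (𝓝 (f v))

end FracVar

end

/-!
Write `Φ(u) = ∫ P(z, D u(z)) dμ(z)` with `D u(x, y) = u(x) - u(y)`, `dμ = K dx dy` and `P` the
primitive of `A` in its last variable. The bounds on `K` make the modular `∫ |D u|^p dμ` comparable
to the Gagliardo modular, and since the exponent is bounded the latter doubles at a bounded rate,
so it defines the norm topology of `W` and is finite and bounded on bounded sets.

As `A` is nondecreasing, `u ↦ ∫ A(z, D u) D(·) dμ` is a field of subgradients of `Φ`. Young's
inequality and dominated convergence show that the field is norm continuous; a continuous field of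
subgradients is the Fréchet derivative, and a functional with a subgradient at every point is
weakly lower semicontinuous.

For `(S₊)`, the hypothesis and the weak convergence give `∫ F_k dμ → 0`, where
`F_k = (A(z, D u_k) - A(z, D u)) (D u_k - D u) ≥ 0`. Strict monotonicity turns `F_k → 0` into
`D u_k → D u` almost everywhere along subsequences, while growth and coercivity yield
`|D u_k - D u|^p ≤ B F_k + g` with `g` integrable. A dominated convergence argument gives
`∫ |D (u_k - u)|^p dμ → 0`.
-/

open scoped NNReal

namespace FracVar

/-! ### Modulars that double at a bounded rate -/

namespace IsConvexModular

variable {V : Type*} [AddCommGroup V] [Module ℝ V] {ρ : V → ℝ≥0∞}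

/-- The `Δ₂` condition of Orlicz theory, under which the modular is finite on the whole modular
space and the Luxemburg norm and the modular define the same convergence to zero. -/
def DeltaTwo (ρ : V → ℝ≥0∞) : Prop := ∃ B : ℝ≥0, ∀ v, ρ ((2 : ℝ) • v) ≤ B * ρ v

theorem smul_le_smul (h : IsConvexModular ρ) (v : V) {a b : ℝ} (hab : |a| ≤ |b|) :
    ρ (a • v) ≤ ρ (b • v) := by
  rcases eq_or_ne b 0 with rfl | hb
  · rw [abs_zero, abs_nonpos_iff] at hab
    rw [hab]
  have hratio : |a| / |b| ≤ 1 := div_le_one_of_le₀ hab (abs_nonneg b)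
  calc ρ (a • v) = ρ ((|a| / |b|) • |b| • v) := by
        rw [smul_smul, div_mul_cancel₀ _ (abs_ne_zero.2 hb), ← h.smul_abs]
    _ ≤ ENNReal.ofReal (|a| / |b|) * ρ (|b| • v) := h.smul_le _ (by positivity) hratio
    _ ≤ ρ (|b| • v) := mul_le_of_le_one_left' (ENNReal.ofReal_le_one.2 hratio)
    _ = ρ (b • v) := (h.smul_abs b v).symm

theorem DeltaTwo.exists_smul_le (hρ : DeltaTwo ρ) (h : IsConvexModular ρ) (r : ℝ) :
    ∃ B : ℝ≥0, ∀ v, ρ (r • v) ≤ B * ρ v := by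
  obtain ⟨B, hB⟩ := hρ
  have hpow : ∀ (n : ℕ) v, ρ ((2 : ℝ) ^ n • v) ≤ (B ^ n : ℝ≥0) * ρ v := by
    intro n v
    induction n with
    | zero => simp
    | succ n ih =>
      calc ρ ((2 : ℝ) ^ (n + 1) • v) = ρ ((2 : ℝ) • (2 : ℝ) ^ n • v) := by
            rw [smul_smul, pow_succ']
        _ ≤ B * ((B ^ n : ℝ≥0) * ρ v) := (hB _).trans (by gcongr)
        _ = (B ^ (n + 1) : ℝ≥0) * ρ v := by rw [← mul_assoc, ← ENNReal.coe_mul, pow_succ']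
  obtain ⟨n, hn⟩ := pow_unbounded_of_one_lt |r| one_lt_two
  refine ⟨B ^ n, fun v => (h.smul_le_smul v ?_).trans (hpow n v)⟩
  exact hn.le.trans (le_abs_self _)

theorem DeltaTwo.lt_top (hρ : DeltaTwo ρ) (h : IsConvexModular ρ) {v : V}
    (hv : ∃ ζ : ℝ, 0 < ζ ∧ ρ (ζ⁻¹ • v) < ∞) : ρ v < ∞ := by
  obtain ⟨ζ, hζ, hfin⟩ := hv
  obtain ⟨B, hB⟩ := hρ.exists_smul_le h ζ
  have hle := hB (ζ⁻¹ • v)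
  rw [smul_inv_smul₀ hζ.ne'] at hle
  exact hle.trans_lt (ENNReal.mul_lt_top ENNReal.coe_lt_top hfin)

theorem inv_smul_le_one_of_lux_lt (h : IsConvexModular ρ) {v : V} {r : ℝ}
    (hv : ∃ ζ : ℝ, 0 < ζ ∧ ρ (ζ⁻¹ • v) < ∞) (hr : lux ρ v < r) : ρ (r⁻¹ • v) ≤ 1 := by
  obtain ⟨ζ, ⟨hζ, hle⟩, hζr⟩ := exists_lt_of_csInf_lt (h.exists_le_one hv) hr
  refine (h.smul_le_smul v ?_).trans hle
  rw [abs_of_pos (inv_pos.2 hζ), abs_of_pos (inv_pos.2 (hζ.trans hζr))]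
  exact inv_anti₀ hζ hζr.le

theorem le_ofReal_of_lux_lt (h : IsConvexModular ρ) {v : V} {r : ℝ} (hr1 : r ≤ 1)
    (hv : ∃ ζ : ℝ, 0 < ζ ∧ ρ (ζ⁻¹ • v) < ∞) (hr : lux ρ v < r) : ρ v ≤ ENNReal.ofReal r := by
  have hr0 : 0 < r := (lux_nonneg v).trans_lt hr
  calc ρ v = ρ (r • r⁻¹ • v) := by rw [smul_inv_smul₀ hr0.ne']
    _ ≤ ENNReal.ofReal r * ρ (r⁻¹ • v) := h.smul_le _ hr0.le hr1
    _ ≤ ENNReal.ofReal r := mul_le_of_le_one_right' (h.inv_smul_le_one_of_lux_lt hv hr)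

theorem DeltaTwo.exists_le_of_lux_le_one (hρ : DeltaTwo ρ) (h : IsConvexModular ρ) :
    ∃ B : ℝ≥0, ∀ v, (∃ ζ : ℝ, 0 < ζ ∧ ρ (ζ⁻¹ • v) < ∞) → lux ρ v ≤ 1 → ρ v ≤ B := by
  obtain ⟨B, hB⟩ := hρ
  refine ⟨B, fun v hv hlux => ?_⟩
  have hhalf : ρ ((2 : ℝ)⁻¹ • v) ≤ 1 :=
    h.inv_smul_le_one_of_lux_lt hv (hlux.trans_lt one_lt_two)
  calc ρ v = ρ ((2 : ℝ) • (2 : ℝ)⁻¹ • v) := by rw [smul_inv_smul₀ two_ne_zero]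
    _ ≤ B * 1 := (hB _).trans (by gcongr)
    _ = B := mul_one _

theorem DeltaTwo.tendsto_lux_zero_iff (hρ : DeltaTwo ρ) (h : IsConvexModular ρ) {ι : Type*}
    {l : Filter ι} {u : ι → V} (hu : ∀ k, ∃ ζ : ℝ, 0 < ζ ∧ ρ (ζ⁻¹ • u k) < ∞) :
    Tendsto (fun k => lux ρ (u k)) l (𝓝 0) ↔ Tendsto (fun k => ρ (u k)) l (𝓝 0) := by
  refine ⟨fun hlim => ENNReal.tendsto_nhds_zero.2 fun ε hε => ?_, fun hlim => ?_⟩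
  · obtain ⟨r, -, hrε⟩ := ENNReal.lt_iff_exists_real_btwn.1 hε
    have hr0 : 0 < r := ENNReal.ofReal_pos.1 hrε.1
    filter_upwards [hlim.eventually_lt_const (lt_min hr0 one_pos)] with k hk
    calc ρ (u k) ≤ ENNReal.ofReal (min r 1) :=
          h.le_ofReal_of_lux_lt (min_le_right _ _) (hu k) hk
      _ ≤ ENNReal.ofReal r := ENNReal.ofReal_le_ofReal (min_le_left _ _)
      _ ≤ ε := hrε.2.le
  · refine tendsto_order.2 ⟨fun b hb => ?_, fun ε hε => ?_⟩
    · exact Eventually.of_forall fun k => hb.trans_le (lux_nonneg _)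
    obtain ⟨B, hB⟩ := hρ.exists_smul_le h (ε / 2)⁻¹
    have hscaled : Tendsto (fun k => (B : ℝ≥0∞) * ρ (u k)) l (𝓝 0) := by
      simpa only [mul_zero] using ENNReal.Tendsto.const_mul hlim (Or.inr ENNReal.coe_ne_top)
    filter_upwards [hscaled.eventually_le_const zero_lt_one] with k hk
    exact (lux_le (half_pos hε) ((hB _).trans hk)).trans_lt (half_lt_self hε)

end IsConvexModular

/-! ### Inequalities for powers -/

theorem tendsto_abs_rpow_zero_iff {ι : Type*} {l : Filter ι} {f : ι → ℝ} {r : ℝ} (hr : 0 < r) :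
    Tendsto (fun k => |f k| ^ r) l (𝓝 0) ↔ Tendsto f l (𝓝 0) := by
  rw [tendsto_zero_iff_abs_tendsto_zero f]
  refine ⟨fun h => ?_, fun h => ?_⟩
  · have hroot := h.rpow_const (p := r⁻¹) (Or.inr (inv_nonneg.2 hr.le))
    rw [Real.zero_rpow (inv_ne_zero hr.ne')] at hroot
    exact hroot.congr fun k => Real.rpow_rpow_inv (abs_nonneg _) hr.ne'
  · have hpow := h.rpow_const (p := r) (Or.inr hr.le)
    rwa [Real.zero_rpow hr.ne'] at hpow

theorem add_rpow_le_mul_add_rpow {a b q M : ℝ} (ha : 0 ≤ a) (hb : 0 ≤ b) (hq : 1 ≤ q)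
    (hM : q ≤ M) : (a + b) ^ q ≤ 2 ^ M * (a ^ q + b ^ q) := by
  lift a to ℝ≥0 using ha
  lift b to ℝ≥0 using hb
  calc ((a : ℝ) + b) ^ q ≤ 2 ^ (q - 1) * ((a : ℝ) ^ q + (b : ℝ) ^ q) := by
        exact_mod_cast NNReal.rpow_add_le_mul_rpow_add_rpow a b hq
    _ ≤ 2 ^ M * ((a : ℝ) ^ q + (b : ℝ) ^ q) := by
        gcongr
        · exact one_le_two
        · linarith

/-- Young's inequality; bounding `q` by `r` makes the constant uniform over a range of exponents. -/
theorem mul_le_mul_rpow_add_rpow_neg_mul {a b p q r δ : ℝ} (ha : 0 ≤ a) (hb : 0 ≤ b)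
    (hpq : p.HolderConjugate q) (hδ : 0 < δ) (hδ1 : δ ≤ 1) (hqr : q ≤ r) :
    a * b ≤ δ * a ^ p + δ ^ (-r) * b ^ q := by
  have hfactor : (δ ^ p⁻¹ * a) * (δ ^ (-p⁻¹) * b) = a * b := by
    rw [mul_mul_mul_comm, ← Real.rpow_add hδ, add_neg_cancel, Real.rpow_zero, one_mul]
  have hfirst : (δ ^ p⁻¹ * a) ^ p = δ * a ^ p := by
    rw [Real.mul_rpow (by positivity) ha, Real.rpow_inv_rpow hδ.le hpq.ne_zero]
  have hsecond : (δ ^ (-p⁻¹) * b) ^ q ≤ δ ^ (-r) * b ^ q := by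
    rw [Real.mul_rpow (by positivity) hb, ← Real.rpow_mul hδ.le]
    refine mul_le_mul_of_nonneg_right ?_ (by positivity)
    refine Real.rpow_le_rpow_of_exponent_ge hδ hδ1 ?_
    have hqp : p⁻¹ * q ≤ 1 * q :=
      mul_le_mul_of_nonneg_right (inv_le_one_of_one_le₀ hpq.lt.le) hpq.symm.nonneg
    linarith
  calc a * b = (δ ^ p⁻¹ * a) * (δ ^ (-p⁻¹) * b) := hfactor.symm
    _ ≤ (δ ^ p⁻¹ * a) ^ p / p + (δ ^ (-p⁻¹) * b) ^ q / q :=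
      Real.young_inequality_of_nonneg (by positivity) (by positivity) hpq
    _ ≤ (δ ^ p⁻¹ * a) ^ p + (δ ^ (-p⁻¹) * b) ^ q :=
      add_le_add (div_le_self (by positivity) hpq.lt.le)
        (div_le_self (by positivity) hpq.symm.lt.le)
    _ ≤ δ * a ^ p + δ ^ (-r) * b ^ q := by linarith

theorem conjExponent_le_conjExponent {p q : ℝ} (hp : 1 < p) (hpq : p ≤ q) :
    q.conjExponent ≤ p.conjExponent := by
  unfold Real.conjExponent
  rw [div_le_div_iff₀ (by linarith) (by linarith)]
  linarith

theorem rpow_sub_one_rpow_conjExponent {a q : ℝ} (ha : 0 ≤ a) (hq : 1 < q) :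
    (a ^ (q - 1)) ^ q.conjExponent = a ^ q := by
  rw [← Real.rpow_mul ha, (Real.HolderConjugate.conjExponent hq).sub_one_mul_conj]

theorem rpow_sub_one_mul_le {a b q : ℝ} (ha : 0 ≤ a) (hb : 0 ≤ b) (hq : 1 < q) :
    a ^ (q - 1) * b ≤ a ^ q + b ^ q := by
  have young := mul_le_mul_rpow_add_rpow_neg_mul (Real.rpow_nonneg ha (q - 1)) hb
    (Real.HolderConjugate.conjExponent hq).symm one_pos le_rfl le_rfl
  simpa [rpow_sub_one_rpow_conjExponent ha hq] using young

theorem abs_rpow_le_abs_sub_rpow_add {s t q M : ℝ} (hq : 1 ≤ q) (hM : q ≤ M) :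
    |s| ^ q ≤ 2 ^ M * (|s - t| ^ q + |t| ^ q) := by
  refine le_trans ?_ (add_rpow_le_mul_add_rpow (abs_nonneg _) (abs_nonneg _) hq hM)
  gcongr
  simpa using abs_add_le (s - t) t

theorem abs_rpow_conjExponent_le {x s q m C : ℝ} (hm : 1 < m) (hq : m ≤ q)
    (hx : |x| ≤ C * |s| ^ (q - 1)) :
    |x| ^ q.conjExponent ≤ max 1 C ^ m.conjExponent * |s| ^ q := by
  have hconj : 0 ≤ q.conjExponent :=
    (Real.HolderConjugate.conjExponent (hm.trans_le hq)).symm.nonneg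
  calc |x| ^ q.conjExponent ≤ (max 1 C * |s| ^ (q - 1)) ^ q.conjExponent := by
        gcongr
        exact hx.trans (by gcongr; exact le_max_right _ _)
    _ = max 1 C ^ q.conjExponent * |s| ^ q := by
        rw [Real.mul_rpow (by positivity) (by positivity),
          rpow_sub_one_rpow_conjExponent (abs_nonneg s) (hm.trans_le hq)]
    _ ≤ max 1 C ^ m.conjExponent * |s| ^ q := by
        gcongr
        · exact le_max_left _ _
        · exact conjExponent_le_conjExponent hm hq

theorem exists_abs_sub_rpow_conjExponent_le {m : ℝ} (hm : 1 < m) (M C : ℝ) :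
    ∃ B, ∀ q x y s t : ℝ, m ≤ q → q ≤ M →
      |x| ≤ C * |s| ^ (q - 1) → |y| ≤ C * |t| ^ (q - 1) →
        |x - y| ^ q.conjExponent ≤ B * (|s - t| ^ q + |t| ^ q) := by
  set r := m.conjExponent
  refine ⟨2 ^ r * max 1 C ^ r * (2 ^ M + 1), fun q x y s t hq hM hx hy => ?_⟩
  have hconj := (Real.HolderConjugate.conjExponent (hm.trans_le hq)).symm
  have hxy : |x| ^ q.conjExponent + |y| ^ q.conjExponent ≤
      max 1 C ^ r * (|s| ^ q + |t| ^ q) := by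
    rw [mul_add]
    exact add_le_add (abs_rpow_conjExponent_le hm hq hx) (abs_rpow_conjExponent_le hm hq hy)
  have hst : |s| ^ q + |t| ^ q ≤ (2 ^ M + 1) * (|s - t| ^ q + |t| ^ q) := by
    have hs := abs_rpow_le_abs_sub_rpow_add (s := s) (t := t) (hm.le.trans hq) hM
    have : 0 ≤ |s - t| ^ q := by positivity
    linarith
  calc |x - y| ^ q.conjExponent ≤ (|x| + |y|) ^ q.conjExponent :=
        Real.rpow_le_rpow (abs_nonneg _) (abs_sub x y) hconj.nonneg
    _ ≤ 2 ^ r * (|x| ^ q.conjExponent + |y| ^ q.conjExponent) :=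
        add_rpow_le_mul_add_rpow (abs_nonneg _) (abs_nonneg _) hconj.lt.le
          (conjExponent_le_conjExponent hm hq)
    _ ≤ 2 ^ r * (max 1 C ^ r * ((2 ^ M + 1) * (|s - t| ^ q + |t| ^ q))) := by
        gcongr
        exact hxy.trans (by gcongr)
    _ = 2 ^ r * max 1 C ^ r * (2 ^ M + 1) * (|s - t| ^ q + |t| ^ q) := by ring

theorem abs_mul_add_abs_mul_le {x y s t q m M C δ : ℝ} (hm : 1 < m) (hq : m ≤ q) (hM : q ≤ M)
    (hC : 0 ≤ C) (hδ : 0 < δ) (hδ1 : δ ≤ 1)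
    (hx : |x| ≤ C * |s| ^ (q - 1)) (hy : |y| ≤ C * |t| ^ (q - 1)) :
    |x * t| + |y * s| ≤
      2 * C * δ * |s| ^ q + C * (δ ^ (-M) + δ ^ (-m.conjExponent)) * |t| ^ q := by
  have hq1 : 1 < q := hm.trans_le hq
  have hconj := Real.HolderConjugate.conjExponent hq1
  have hxt : |s| ^ (q - 1) * |t| ≤ δ * |s| ^ q + δ ^ (-M) * |t| ^ q := by
    have young := mul_le_mul_rpow_add_rpow_neg_mul (Real.rpow_nonneg (abs_nonneg s) (q - 1))
      (abs_nonneg t) hconj.symm hδ hδ1 hM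
    rwa [rpow_sub_one_rpow_conjExponent (abs_nonneg s) hq1] at young
  have hys : |s| * |t| ^ (q - 1) ≤ δ * |s| ^ q + δ ^ (-m.conjExponent) * |t| ^ q := by
    have young := mul_le_mul_rpow_add_rpow_neg_mul (abs_nonneg s)
      (Real.rpow_nonneg (abs_nonneg t) (q - 1)) hconj hδ hδ1 (conjExponent_le_conjExponent hm hq)
    rwa [rpow_sub_one_rpow_conjExponent (abs_nonneg t) hq1] at young
  calc |x * t| + |y * s| = |x| * |t| + |y| * |s| := by rw [abs_mul, abs_mul]
    _ ≤ C * |s| ^ (q - 1) * |t| + C * |t| ^ (q - 1) * |s| := by gcongr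
    _ = C * (|s| ^ (q - 1) * |t| + |s| * |t| ^ (q - 1)) := by ring
    _ ≤ C * (δ * |s| ^ q + δ ^ (-M) * |t| ^ q +
          (δ * |s| ^ q + δ ^ (-m.conjExponent) * |t| ^ q)) := by gcongr
    _ = _ := by ring

/-- Coercivity and growth absorb the cross terms of `(x - y) (s - t)`, where `x` and `y` stand for
the values at `s` and `t` of a nonlinearity of growth `q - 1`. -/
theorem exists_abs_sub_rpow_le {c C m : ℝ} (hc : 0 < c) (hC : 0 ≤ C) (hm : 1 < m) (M : ℝ) :
    ∃ B B', ∀ q x y s t : ℝ, m ≤ q → q ≤ M → c * |s| ^ q ≤ x * s → 0 ≤ y * t →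
      |x| ≤ C * |s| ^ (q - 1) → |y| ≤ C * |t| ^ (q - 1) →
        |s - t| ^ q ≤ B * ((x - y) * (s - t)) + B' * |t| ^ q := by
  set δ : ℝ := c / (4 * (C + c))
  have hδ : 0 < δ := by positivity
  have hδ1 : δ ≤ 1 := div_le_one_of_le₀ (by linarith) (by positivity)
  have hCδ : 2 * C * δ ≤ c / 2 := by
    rw [← mul_div_assoc, div_le_iff₀ (by positivity)]
    nlinarith
  set L := C * (δ ^ (-M) + δ ^ (-m.conjExponent))
  refine ⟨2 ^ M * (2 / c), 2 ^ M * (2 * L / c + 1), fun q x y s t hq hM hxs hyt hx hy => ?_⟩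
  have hs : |s| ^ q ≤ 2 / c * ((x - y) * (s - t)) + 2 * L / c * |t| ^ q := by
    have hcross := abs_mul_add_abs_mul_le hm hq hM hC hδ hδ1 hx hy
    have habsorb : 2 * C * δ * |s| ^ q ≤ c / 2 * |s| ^ q := by gcongr
    have hle : c / 2 * |s| ^ q ≤ (x - y) * (s - t) + L * |t| ^ q := by
      linarith [le_abs_self (x * t), le_abs_self (y * s)]
    calc |s| ^ q = 2 / c * (c / 2 * |s| ^ q) := by field_simp
      _ ≤ 2 / c * ((x - y) * (s - t) + L * |t| ^ q) := by gcongr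
      _ = _ := by ring
  calc |s - t| ^ q ≤ (|s| + |t|) ^ q :=
        Real.rpow_le_rpow (abs_nonneg _) (abs_sub s t) (by linarith)
    _ ≤ 2 ^ M * (|s| ^ q + |t| ^ q) :=
        add_rpow_le_mul_add_rpow (abs_nonneg _) (abs_nonneg _) (hm.le.trans hq) hM
    _ ≤ 2 ^ M * (2 / c * ((x - y) * (s - t)) + 2 * L / c * |t| ^ q + |t| ^ q) := by gcongr
    _ = _ := by ring

/-! ### Dominated convergence in the mean -/

section DominatedConvergence

variable {X : Type*} [MeasurableSpace X] {μ : Measure X} {F G : ℕ → X → ℝ} {g : X → ℝ}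

theorem exists_subseq_tendsto_ae_zero (hF : ∀ k, Integrable (F k) μ) (hF0 : ∀ k x, 0 ≤ F k x)
    (h : Tendsto (fun k => ∫ x, F k x ∂μ) atTop (𝓝 0)) :
    ∃ ns : ℕ → ℕ, StrictMono ns ∧ ∀ᵐ x ∂μ, Tendsto (fun k => F (ns k) x) atTop (𝓝 0) := by
  have hnorm : ∀ k, eLpNorm (F k - fun _ => (0 : ℝ)) 1 μ = ENNReal.ofReal (∫ x, F k x ∂μ) := by
    intro k
    rw [show (F k - fun _ => (0 : ℝ)) = F k from sub_zero _, eLpNorm_one_eq_lintegral_enorm,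
      ofReal_integral_eq_lintegral_ofReal (hF k) (ae_of_all _ (hF0 k))]
    exact lintegral_congr fun x => Real.enorm_of_nonneg (hF0 k x)
  have hmeasure : TendstoInMeasure μ F atTop fun _ => (0 : ℝ) := by
    refine tendstoInMeasure_of_tendsto_eLpNorm one_ne_zero (fun k => (hF k).aestronglyMeasurable)
      aestronglyMeasurable_const ?_
    simp_rw [hnorm]
    simpa only [ENNReal.ofReal_zero] using ENNReal.tendsto_ofReal h
  exact hmeasure.exists_seq_tendsto_ae

theorem tendsto_integral_zero_of_le_add (hF : ∀ k, Integrable (F k) μ)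
    (hG : ∀ k, Integrable (G k) μ) (hG0 : ∀ k x, 0 ≤ G k x) (hg : Integrable g μ)
    (hle : ∀ k, ∀ᵐ x ∂μ, G k x ≤ F k x + g x)
    (hFlim : ∀ᵐ x ∂μ, Tendsto (fun k => F k x) atTop (𝓝 0))
    (hGlim : ∀ᵐ x ∂μ, Tendsto (fun k => G k x) atTop (𝓝 0))
    (h : Tendsto (fun k => ∫ x, F k x ∂μ) atTop (𝓝 0)) :
    Tendsto (fun k => ∫ x, G k x ∂μ) atTop (𝓝 0) := by
  have hexcess : ∀ k, Integrable (fun x => max (G k x - F k x) 0) μ := fun k =>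
    ((hG k).sub (hF k)).sup (integrable_zero _ _ _)
  have hexcess_lim : Tendsto (fun k => ∫ x, max (G k x - F k x) 0 ∂μ) atTop (𝓝 0) := by
    suffices h0 : Tendsto (fun k => ∫ x, max (G k x - F k x) 0 ∂μ) atTop (𝓝 (∫ _, 0 ∂μ)) by
      simpa only [integral_zero] using h0
    refine tendsto_integral_of_dominated_convergence (fun x => |g x|)
      (fun k => (hexcess k).aestronglyMeasurable) hg.abs (fun k => ?_) ?_
    · filter_upwards [hle k] with x hx
      rw [Real.norm_of_nonneg (le_max_right _ _)]
      exact max_le (by linarith [le_abs_self (g x)]) (abs_nonneg _)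
    · filter_upwards [hFlim, hGlim] with x hFx hGx
      simpa only [sub_zero, max_self] using (hGx.sub hFx).max (tendsto_const_nhds (x := (0 : ℝ)))
  refine squeeze_zero (fun k => integral_nonneg (hG0 k)) (fun k => ?_)
    (by simpa only [add_zero] using hexcess_lim.add h)
  rw [← integral_add (hexcess k) (hF k)]
  refine integral_mono (hG k) ((hexcess k).add (hF k)) fun x => ?_
  linarith [le_max_left (G k x - F k x) 0]

/-- The hypothesis `hlim` says that `G k x → 0` along every subsequence on which `F k x → 0`. -/
theorem tendsto_integral_zero_of_le_mul_add (B : ℝ) (hF : ∀ k, Integrable (F k) μ)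
    (hF0 : ∀ k x, 0 ≤ F k x) (hG : ∀ k, Integrable (G k) μ) (hG0 : ∀ k x, 0 ≤ G k x)
    (hg : Integrable g μ) (hle : ∀ k, ∀ᵐ x ∂μ, G k x ≤ B * F k x + g x)
    (hlim : ∀ᵐ x ∂μ, Tendsto (fun k => G k x) (comap (fun k => F k x) (𝓝 0)) (𝓝 0))
    (h : Tendsto (fun k => ∫ x, F k x ∂μ) atTop (𝓝 0)) :
    Tendsto (fun k => ∫ x, G k x ∂μ) atTop (𝓝 0) := by
  refine tendsto_of_subseq_tendsto fun ns hns => ?_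
  obtain ⟨ms, hms, hae⟩ := exists_subseq_tendsto_ae_zero (fun k => hF (ns k))
    (fun k => hF0 (ns k)) (h.comp hns)
  refine ⟨ms, tendsto_integral_zero_of_le_add (F := fun k x => B * F (ns (ms k)) x)
    (fun k => (hF _).const_mul B) (fun k => hG _) (fun k => hG0 _) hg (fun k => hle _) ?_ ?_ ?_⟩
  · filter_upwards [hae] with x hx
    simpa only [mul_zero] using hx.const_mul B
  · filter_upwards [hae, hlim] with x hx hGx
    exact hGx.comp (tendsto_comap_iff.2 hx)
  · simpa only [Function.comp_def, integral_const_mul, mul_zero] using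
      (h.comp (hns.comp hms.tendsto_atTop)).const_mul B

end DominatedConvergence

/-! ### Monotone functions of a real variable -/

theorem mul_sub_le_integral_of_monotone {a : ℝ → ℝ} (ha : Monotone a) (s t : ℝ) :
    a t * (s - t) ≤ (∫ τ in (0 : ℝ)..s, a τ) - ∫ τ in (0 : ℝ)..t, a τ := by
  have hint : ∀ b c : ℝ, IntervalIntegrable a volume b c := fun _ _ => ha.intervalIntegrable
  rw [intervalIntegral.integral_interval_sub_left (hint _ _) (hint _ _)]
  rcases le_total t s with hts | hst
  · calc a t * (s - t) = ∫ _ in t..s, a t := by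
          rw [intervalIntegral.integral_const, smul_eq_mul, mul_comm]
      _ ≤ ∫ τ in t..s, a τ :=
          intervalIntegral.integral_mono_on hts intervalIntegrable_const (hint _ _)
            fun τ hτ => ha hτ.1
  · rw [intervalIntegral.integral_symm s t, ← neg_sub t s, mul_neg, neg_le_neg_iff]
    calc ∫ τ in s..t, a τ ≤ ∫ _ in s..t, a t :=
          intervalIntegral.integral_mono_on hst (hint _ _) intervalIntegrable_const
            fun τ hτ => ha hτ.2
      _ = a t * (t - s) := by rw [intervalIntegral.integral_const, smul_eq_mul, mul_comm]

theorem min_mul_le_mul_sub_of_monotone {a : ℝ → ℝ} (ha : Monotone a) {s t ε : ℝ} (hε : 0 ≤ ε)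
    (h : ε ≤ |s - t|) :
    min (a (t + ε) - a t) (a t - a (t - ε)) * ε ≤ (a s - a t) * (s - t) := by
  have hgap : 0 ≤ min (a (t + ε) - a t) (a t - a (t - ε)) :=
    le_min (sub_nonneg.2 (ha (by linarith))) (sub_nonneg.2 (ha (by linarith)))
  rcases le_abs.1 h with hst | hts
  · refine mul_le_mul ((min_le_left _ _).trans ?_) hst hε (hgap.trans ((min_le_left _ _).trans ?_))
    all_goals linarith [ha (show t + ε ≤ s by linarith)]
  · rw [← neg_mul_neg (a s - a t)]
    refine mul_le_mul ((min_le_right _ _).trans ?_) hts hε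
      (hgap.trans ((min_le_right _ _).trans ?_))
    all_goals linarith [ha (show s ≤ t - ε by linarith)]

theorem tendsto_of_strictMono_of_tendsto_mul_sub {a : ℝ → ℝ} (ha : StrictMono a) {ι : Type*}
    {l : Filter ι} {f : ι → ℝ} {t : ℝ}
    (h : Tendsto (fun k => (a (f k) - a t) * (f k - t)) l (𝓝 0)) : Tendsto f l (𝓝 t) := by
  refine Metric.tendsto_nhds.2 fun ε hε => ?_
  have hgap : 0 < min (a (t + ε) - a t) (a t - a (t - ε)) * ε :=
    mul_pos (lt_min (sub_pos.2 (ha (by linarith))) (sub_pos.2 (ha (by linarith)))) hε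
  filter_upwards [h.eventually_lt_const hgap] with k hk
  rw [Real.dist_eq]
  by_contra! hfar
  exact hk.not_ge (min_mul_le_mul_sub_of_monotone ha.monotone hε.le hfar)

/-! ### Subgradients on a normed space -/

section Subgradient

variable {V : Type*} [NormedAddCommGroup V] [NormedSpace ℝ V] {f : V → ℝ} {g : V → StrongDual ℝ V}

/-- `g` selects a subgradient of `f` at every point; such an `f` is convex. -/
def IsSubgradientField (f : V → ℝ) (g : V → StrongDual ℝ V) : Prop :=
  ∀ u v, g u (v - u) ≤ f v - f u

/-- Sequential lower semicontinuity for the weak topology. The limit inferior is taken in `EReal`,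
where it does not depend on boundedness. -/
def WeakSeqLowerSemicontinuous (f : V → ℝ) : Prop :=
  ∀ (u : ℕ → V) (v : V), WeakTendsto u v →
    (f v : EReal) ≤ liminf (fun k => (f (u k) : EReal)) atTop

/-- The type `(S₊)` condition of Browder for an operator from `V` to its dual. -/
def IsTypeSPlus (g : V → StrongDual ℝ V) : Prop :=
  ∀ (u : ℕ → V) (v : V), WeakTendsto u v →
    limsup (fun k => (g (u k) (u k - v) : EReal)) atTop ≤ 0 → Tendsto u atTop (𝓝 v)

theorem WeakTendsto.tendsto_apply_sub {u : ℕ → V} {v : V} (h : WeakTendsto u v)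
    (l : StrongDual ℝ V) : Tendsto (fun k => l (u k - v)) atTop (𝓝 0) := by
  simpa only [sub_self, map_sub] using (h l).sub_const (l v)

theorem WeakTendsto.tendsto_sub_apply_sub_of_limsup_le {u : ℕ → V} {v : V} (h : WeakTendsto u v)
    (hmono : ∀ k, 0 ≤ (g (u k) - g v) (u k - v))
    (hlim : limsup (fun k => (g (u k) (u k - v) : EReal)) atTop ≤ 0) :
    Tendsto (fun k => (g (u k) - g v) (u k - v)) atTop (𝓝 0) := by
  refine tendsto_order.2 ⟨fun b hb => Eventually.of_forall fun k => hb.trans_le (hmono k),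
    fun ε hε => ?_⟩
  have hsmall : ∀ᶠ k in atTop, (g (u k) (u k - v) : EReal) < ((ε / 2 : ℝ) : EReal) :=
    eventually_lt_of_limsup_lt (hlim.trans_lt (by exact_mod_cast half_pos hε))
  filter_upwards [hsmall, (h.tendsto_apply_sub (g v)).eventually_const_lt
    (neg_lt_zero.2 (half_pos hε))] with k hk hvk
  have := EReal.coe_lt_coe_iff.1 hk
  rw [sub_apply]
  linarith

namespace IsSubgradientField

theorem hasFDerivAt (h : IsSubgradientField f g) {u : V} (hg : ContinuousAt g u) :
    HasFDerivAt f (g u) u := by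
  refine .of_isLittleO (Asymptotics.isLittleO_iff.2 fun ε hε => ?_)
  filter_upwards [hg.eventually (Metric.ball_mem_nhds _ hε)] with v hv
  have hlower : 0 ≤ f v - f u - g u (v - u) := by linarith [h u v]
  have hupper : f v - f u ≤ g v (v - u) := by
    have := h v u
    rw [← neg_sub v u, map_neg] at this
    linarith
  calc ‖f v - f u - g u (v - u)‖ = f v - f u - g u (v - u) := Real.norm_of_nonneg hlower
    _ ≤ (g v - g u) (v - u) := by rw [sub_apply]; linarith
    _ ≤ ‖(g v - g u) (v - u)‖ := Real.le_norm_self _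
    _ ≤ ‖g v - g u‖ * ‖v - u‖ := ContinuousLinearMap.le_opNorm _ _
    _ ≤ ε * ‖v - u‖ := by gcongr; exact (mem_ball_iff_norm.1 hv).le

theorem contDiff (h : IsSubgradientField f g) (hg : Continuous g) : ContDiff ℝ 1 f :=
  contDiff_one_iff_hasFDerivAt.2 ⟨g, hg, fun _ => h.hasFDerivAt hg.continuousAt⟩

theorem weakSeqLowerSemicontinuous (h : IsSubgradientField f g) :
    WeakSeqLowerSemicontinuous f := by
  intro u v huv
  have haffine : Tendsto (fun k => f v + g v (u k - v)) atTop (𝓝 (f v)) := by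
    simpa only [add_zero] using (huv.tendsto_apply_sub (g v)).const_add (f v)
  rw [← ((continuous_coe_real_ereal.tendsto _).comp haffine).liminf_eq]
  refine liminf_le_liminf (Eventually.of_forall fun k => EReal.coe_le_coe_iff.2 ?_)
  linarith [h v (u k)]

end IsSubgradientField

end Subgradient

/-! ### Energies with monotone nonlinearities -/

section Energy

variable {X V : Type*} [MeasurableSpace X] [NormedAddCommGroup V] [NormedSpace ℝ V]

/-- A map `D` from `V` to the measurable functions on `X`, linear modulo equality almost
everywhere, such that the modular `∫ |D u|^q dμ` is finite, bounded on the unit ball, and induces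
the topology of `V`. -/
structure IsModularMap (μ : Measure X) (q : X → ℝ) (D : V → X → ℝ) : Prop where
  measurable : ∀ u, Measurable (D u)
  add : ∀ u v, ∀ᵐ x ∂μ, D (u + v) x = D u x + D v x
  smul : ∀ (c : ℝ) u, ∀ᵐ x ∂μ, D (c • u) x = c * D u x
  integrable : ∀ u, Integrable (fun x => |D u x| ^ q x) μ
  bounded : ∃ R, ∀ u, ‖u‖ ≤ 1 → ∫ x, |D u x| ^ q x ∂μ ≤ R
  tendsto_zero_iff : ∀ u : ℕ → V,
    Tendsto u atTop (𝓝 0) ↔ Tendsto (fun k => ∫ x, |D (u k) x| ^ q x ∂μ) atTop (𝓝 0)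

/-- A Carathéodory nonlinearity `a(x, t)`, nondecreasing in `t` and of growth `q(x) - 1`, for an
exponent `q` with values in a compact subinterval `[m, M]` of `(1, ∞)`. -/
structure IsMonotoneNonlinearity (q : X → ℝ) (a : X → ℝ → ℝ) (m M C : ℝ) : Prop where
  measurable_exponent : Measurable q
  one_lt : 1 < m
  le_exponent : ∀ x, m ≤ q x
  exponent_le : ∀ x, q x ≤ M
  measurable : Measurable (Function.uncurry a)
  continuous : ∀ x, Continuous (a x)
  monotone : ∀ x, Monotone (a x)
  growth : ∀ x t, |a x t| ≤ C * |t| ^ (q x - 1)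
  nonneg : 0 ≤ C

/-- The primitive of `a x` vanishing at `0`. -/
noncomputable def primitive (a : X → ℝ → ℝ) (x : X) (t : ℝ) : ℝ := ∫ τ in (0 : ℝ)..t, a x τ

/-- The functional `u ↦ ∫ P(x, D u(x)) dμ(x)`, where `P` is the primitive of `a`. -/
noncomputable def energy (μ : Measure X) (a : X → ℝ → ℝ) (D : V → X → ℝ) (u : V) : ℝ :=
  ∫ x, primitive a x (D u x) ∂μ

variable {μ : Measure X} {q : X → ℝ} {D : V → X → ℝ} {a : X → ℝ → ℝ} {m M c C : ℝ}

theorem measurable_primitive (ha : Measurable (Function.uncurry a)) :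
    Measurable (Function.uncurry (primitive a)) := by
  have hscale : Function.uncurry (primitive a) =
      fun w => w.2 * ∫ σ in Set.Ioc (0 : ℝ) 1, a w.1 (w.2 * σ) := by
    funext w
    rw [← intervalIntegral.integral_of_le zero_le_one,
      intervalIntegral.mul_integral_comp_mul_left, mul_zero, mul_one]
    rfl
  have hmeas : Measurable (Function.uncurry fun (w : X × ℝ) (σ : ℝ) => a w.1 (w.2 * σ)) :=
    ha.comp (g := Function.uncurry a) (f := fun v : (X × ℝ) × ℝ => (v.1.1, v.1.2 * v.2))
      (by fun_prop)
  rw [hscale]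
  exact measurable_snd.mul hmeas.stronglyMeasurable.integral_prod_right.measurable

theorem IsModularMap.sub (hD : IsModularMap μ q D) (u v : V) :
    ∀ᵐ x ∂μ, D (u - v) x = D u x - D v x := by
  filter_upwards [hD.add (u - v) v] with x hx
  rw [sub_add_cancel] at hx
  linarith

namespace IsMonotoneNonlinearity

theorem one_lt_exponent (ha : IsMonotoneNonlinearity q a m M C) (x : X) : 1 < q x :=
  ha.one_lt.trans_le (ha.le_exponent x)

theorem measurable_comp (ha : IsMonotoneNonlinearity q a m M C) {f : X → ℝ} (hf : Measurable f) :
    Measurable fun x => a x (f x) :=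
  ha.measurable.comp (measurable_id.prodMk hf)

theorem sub_mul_sub_nonneg (ha : IsMonotoneNonlinearity q a m M C) (x : X) (s t : ℝ) :
    0 ≤ (a x s - a x t) * (s - t) := by
  rcases le_total s t with h | h
  · exact mul_nonneg_of_nonpos_of_nonpos (sub_nonpos.2 (ha.monotone x h)) (sub_nonpos.2 h)
  · exact mul_nonneg (sub_nonneg.2 (ha.monotone x h)) (sub_nonneg.2 h)

theorem abs_mul_le (ha : IsMonotoneNonlinearity q a m M C) (x : X) (s t : ℝ) :
    |a x s * t| ≤ C * (|s| ^ q x + |t| ^ q x) := by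
  have hC := ha.nonneg
  calc |a x s * t| = |a x s| * |t| := abs_mul _ _
    _ ≤ C * |s| ^ (q x - 1) * |t| := by gcongr; exact ha.growth x s
    _ = C * (|s| ^ (q x - 1) * |t|) := mul_assoc _ _ _
    _ ≤ C * (|s| ^ q x + |t| ^ q x) := by
        gcongr
        exact rpow_sub_one_mul_le (abs_nonneg _) (abs_nonneg _) (ha.one_lt_exponent x)

theorem abs_primitive_le (ha : IsMonotoneNonlinearity q a m M C) (x : X) (t : ℝ) :
    |primitive a x t| ≤ C * |t| ^ q x := by
  have hq := ha.one_lt_exponent x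
  have hC := ha.nonneg
  have hbound : ∀ τ ∈ Set.uIoc 0 t, ‖a x τ‖ ≤ C * |t| ^ (q x - 1) := fun τ hτ => by
    have hτt : |τ| ≤ |t| := by
      simpa using Set.abs_sub_left_of_mem_uIcc (Set.uIoc_subset_uIcc hτ)
    exact (ha.growth x τ).trans (by gcongr)
  calc |primitive a x t| ≤ C * |t| ^ (q x - 1) * |t - 0| :=
        intervalIntegral.norm_integral_le_of_norm_le_const hbound
    _ = C * |t| ^ q x := by
        rw [sub_zero, mul_assoc, ← Real.rpow_add_one' (abs_nonneg t) (by linarith),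
          sub_add_cancel]

theorem integrable_primitive (ha : IsMonotoneNonlinearity q a m M C) (hD : IsModularMap μ q D)
    (u : V) : Integrable (fun x => primitive a x (D u x)) μ :=
  ((hD.integrable u).const_mul C).mono'
    ((measurable_primitive ha.measurable).comp
      (measurable_id.prodMk (hD.measurable u))).aestronglyMeasurable
    (ae_of_all _ fun x => ha.abs_primitive_le x _)

theorem integrable_mul (ha : IsMonotoneNonlinearity q a m M C) (hD : IsModularMap μ q D)
    (u v : V) : Integrable (fun x => a x (D u x) * D v x) μ :=
  (((hD.integrable u).add (hD.integrable v)).const_mul C).mono'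
    ((ha.measurable_comp (hD.measurable u)).mul (hD.measurable v)).aestronglyMeasurable
    (ae_of_all _ fun x => ha.abs_mul_le x _ _)

/-- The linear form `v ↦ ∫ a(x, D u) D v dμ`, before its continuity is known. -/
noncomputable def gradientLinear (ha : IsMonotoneNonlinearity q a m M C)
    (hD : IsModularMap μ q D) (u : V) : V →ₗ[ℝ] ℝ where
  toFun v := ∫ x, a x (D u x) * D v x ∂μ
  map_add' v w := by
    rw [← integral_add (ha.integrable_mul hD u v) (ha.integrable_mul hD u w)]
    refine integral_congr_ae ?_
    filter_upwards [hD.add v w] with x hx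
    rw [hx, mul_add]
  map_smul' r v := by
    rw [RingHom.id_apply, smul_eq_mul, ← integral_const_mul]
    refine integral_congr_ae ?_
    filter_upwards [hD.smul r v] with x hx
    rw [hx, mul_left_comm]

theorem exists_norm_gradientLinear_le (ha : IsMonotoneNonlinearity q a m M C)
    (hD : IsModularMap μ q D) (u : V) : ∃ B, ∀ v, ‖ha.gradientLinear hD u v‖ ≤ B * ‖v‖ := by
  obtain ⟨R, hR⟩ := hD.bounded
  have hC := ha.nonneg
  refine ⟨_, LinearMap.bound_of_ball_bound' one_pos (C * ((∫ x, |D u x| ^ q x ∂μ) + R)) _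
    fun v hv => ?_⟩
  calc ‖ha.gradientLinear hD u v‖ ≤ ∫ x, C * (|D u x| ^ q x + |D v x| ^ q x) ∂μ :=
        norm_integral_le_of_norm_le (((hD.integrable u).add (hD.integrable v)).const_mul C)
          (ae_of_all _ fun x => ha.abs_mul_le x _ _)
    _ = C * ((∫ x, |D u x| ^ q x ∂μ) + ∫ x, |D v x| ^ q x ∂μ) := by
        rw [integral_const_mul, integral_add (hD.integrable u) (hD.integrable v)]
    _ ≤ C * ((∫ x, |D u x| ^ q x ∂μ) + R) := by
        gcongr
        exact hR v (mem_closedBall_zero_iff.1 hv)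

/-- The continuous linear form `v ↦ ∫ a(x, D u) D v dμ`, the derivative of the energy at `u`. -/
noncomputable def gradient (ha : IsMonotoneNonlinearity q a m M C) (hD : IsModularMap μ q D)
    (u : V) : StrongDual ℝ V :=
  (ha.gradientLinear hD u).mkContinuousOfExistsBound (ha.exists_norm_gradientLinear_le hD u)

theorem gradient_apply (ha : IsMonotoneNonlinearity q a m M C) (hD : IsModularMap μ q D)
    (u v : V) : ha.gradient hD u v = ∫ x, a x (D u x) * D v x ∂μ := rfl

theorem gradient_sub_apply (ha : IsMonotoneNonlinearity q a m M C) (hD : IsModularMap μ q D)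
    (u v w : V) : (ha.gradient hD u - ha.gradient hD v) w =
      ∫ x, (a x (D u x) - a x (D v x)) * D w x ∂μ := by
  simp only [sub_apply, gradient_apply, sub_mul]
  exact (integral_sub (ha.integrable_mul hD u w) (ha.integrable_mul hD v w)).symm

theorem isSubgradientField_gradient (ha : IsMonotoneNonlinearity q a m M C)
    (hD : IsModularMap μ q D) : IsSubgradientField (energy μ a D) (ha.gradient hD) := by
  intro u v
  unfold energy
  rw [gradient_apply, ← integral_sub (ha.integrable_primitive hD v) (ha.integrable_primitive hD u)]
  refine integral_mono_ae (ha.integrable_mul hD u _)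
    ((ha.integrable_primitive hD v).sub (ha.integrable_primitive hD u)) ?_
  filter_upwards [hD.sub v u] with x hx
  rw [hx]
  exact mul_sub_le_integral_of_monotone (ha.monotone x) _ _

theorem exists_abs_sub_rpow_conjExponent_le (ha : IsMonotoneNonlinearity q a m M C)
    (hD : IsModularMap μ q D) : ∃ B, ∀ u v : V, ∀ᵐ x ∂μ,
      |a x (D u x) - a x (D v x)| ^ (q x).conjExponent ≤
        B * |D (u - v) x| ^ q x + B * |D v x| ^ q x := by
  obtain ⟨B, hB⟩ := FracVar.exists_abs_sub_rpow_conjExponent_le ha.one_lt M C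
  refine ⟨B, fun u v => ?_⟩
  filter_upwards [hD.sub u v] with x hx
  rw [hx, ← mul_add]
  exact hB _ _ _ _ _ (ha.le_exponent x) (ha.exponent_le x) (ha.growth x _) (ha.growth x _)

theorem integrable_abs_sub_rpow_conjExponent (ha : IsMonotoneNonlinearity q a m M C)
    (hD : IsModularMap μ q D) (u v : V) :
    Integrable (fun x => |a x (D u x) - a x (D v x)| ^ (q x).conjExponent) μ := by
  obtain ⟨B, hB⟩ := ha.exists_abs_sub_rpow_conjExponent_le hD
  have hdiff : Measurable fun x => |a x (D u x) - a x (D v x)| :=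
    ((ha.measurable_comp (hD.measurable u)).sub (ha.measurable_comp (hD.measurable v))).abs
  have hconj : Measurable fun x => (q x).conjExponent :=
    ha.measurable_exponent.div (ha.measurable_exponent.sub_const 1)
  refine (((hD.integrable (u - v)).const_mul B).add ((hD.integrable v).const_mul B)).mono'
    (hdiff.pow hconj).aestronglyMeasurable ?_
  filter_upwards [hB u v] with x hx
  rwa [Real.norm_of_nonneg (by positivity)]

theorem tendsto_integral_abs_sub_rpow_conjExponent (ha : IsMonotoneNonlinearity q a m M C)
    (hD : IsModularMap μ q D) {u : ℕ → V} {v : V} (h : Tendsto u atTop (𝓝 v)) :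
    Tendsto (fun k => ∫ x, |a x (D (u k) x) - a x (D v x)| ^ (q x).conjExponent ∂μ) atTop
      (𝓝 0) := by
  obtain ⟨B, hB⟩ := ha.exists_abs_sub_rpow_conjExponent_le hD
  refine tendsto_integral_zero_of_le_mul_add B (F := fun k x => |D (u k - v) x| ^ q x)
    (fun k => hD.integrable _) (fun k x => by positivity)
    (fun k => ha.integrable_abs_sub_rpow_conjExponent hD _ _) (fun k x => by positivity)
    ((hD.integrable v).const_mul B) (fun k => hB (u k) v) ?_
    ((hD.tendsto_zero_iff _).1 (tendsto_sub_nhds_zero_iff.2 h))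
  filter_upwards [ae_all_iff.2 fun k => hD.sub (u k) v] with x hx
  have hq := ha.one_lt_exponent x
  have hDu : Tendsto (fun k => D (u k) x) (comap (fun k => |D (u k - v) x| ^ q x) (𝓝 0))
      (𝓝 (D v x)) := by
    simp only [hx]
    exact tendsto_sub_nhds_zero_iff.1
      ((tendsto_abs_rpow_zero_iff (one_pos.trans hq)).1 tendsto_comap)
  exact (tendsto_abs_rpow_zero_iff (Real.HolderConjugate.conjExponent hq).symm.pos).2
    (tendsto_sub_nhds_zero_iff.2 (((ha.continuous x).tendsto _).comp hDu))

theorem norm_gradient_sub_le (ha : IsMonotoneNonlinearity q a m M C) (hD : IsModularMap μ q D)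
    {R δ : ℝ} (hR : ∀ u, ‖u‖ ≤ 1 → ∫ x, |D u x| ^ q x ∂μ ≤ R) (hδ : 0 < δ) (hδ1 : δ ≤ 1)
    (u v : V) : ‖ha.gradient hD u - ha.gradient hD v‖ ≤ δ * R + δ ^ (-m.conjExponent) *
      ∫ x, |a x (D u x) - a x (D v x)| ^ (q x).conjExponent ∂μ := by
  have hconj := ha.integrable_abs_sub_rpow_conjExponent hD u v
  have hR0 : 0 ≤ R := (integral_nonneg fun x => by positivity).trans (hR 0 (by simp))
  refine ContinuousLinearMap.opNorm_le_of_unit_norm (by positivity) fun w hw => ?_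
  rw [gradient_sub_apply]
  have young : ∀ x, ‖(a x (D u x) - a x (D v x)) * D w x‖ ≤ δ * |D w x| ^ q x +
      δ ^ (-m.conjExponent) * |a x (D u x) - a x (D v x)| ^ (q x).conjExponent := fun x => by
    rw [mul_comm, norm_mul]
    exact mul_le_mul_rpow_add_rpow_neg_mul (norm_nonneg _) (norm_nonneg _)
      (Real.HolderConjugate.conjExponent (ha.one_lt_exponent x)) hδ hδ1
      (conjExponent_le_conjExponent ha.one_lt (ha.le_exponent x))
  refine (norm_integral_le_of_norm_le (((hD.integrable w).const_mul δ).add (hconj.const_mul _))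
    (ae_of_all _ young)).trans ?_
  rw [integral_add' ((hD.integrable w).const_mul δ) (hconj.const_mul _), integral_const_mul,
    integral_const_mul]
  gcongr
  exact hR w hw.le

theorem continuous_gradient (ha : IsMonotoneNonlinearity q a m M C) (hD : IsModularMap μ q D) :
    Continuous (ha.gradient hD) := by
  refine continuous_iff_seqContinuous.2 fun u v hu => ?_
  obtain ⟨R, hR⟩ := hD.bounded
  refine tendsto_iff_norm_sub_tendsto_zero.2 (tendsto_order.2
    ⟨fun b hb => Eventually.of_forall fun k => hb.trans_le (norm_nonneg _), fun ε hε => ?_⟩)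
  obtain ⟨δ, hδR, hδ1, hδ⟩ : ∃ δ : ℝ, δ * R < ε ∧ δ ≤ 1 ∧ 0 < δ := by
    have hsmall : ∀ᶠ δ in 𝓝[>] (0 : ℝ), δ * R < ε :=
      (continuous_mul_const R).continuousWithinAt.eventually_lt_const
        (by simpa only [zero_mul] using hε)
    obtain ⟨δ, hδR, hδ⟩ := (hsmall.and (Ioc_mem_nhdsGT one_pos)).exists
    exact ⟨δ, hδR, hδ.2, hδ.1⟩
  have hlim := ((ha.tendsto_integral_abs_sub_rpow_conjExponent hD hu).const_mul
    (δ ^ (-m.conjExponent))).const_add (δ * R)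
  rw [mul_zero, add_zero] at hlim
  filter_upwards [hlim.eventually_lt_const hδR] with k hk
  exact (ha.norm_gradient_sub_le hD hR hδ hδ1 _ _).trans_lt hk

theorem hasFDerivAt_energy (ha : IsMonotoneNonlinearity q a m M C) (hD : IsModularMap μ q D)
    (u : V) : HasFDerivAt (energy μ a D) (ha.gradient hD u) u :=
  (ha.isSubgradientField_gradient hD).hasFDerivAt (ha.continuous_gradient hD).continuousAt

theorem contDiff_energy (ha : IsMonotoneNonlinearity q a m M C) (hD : IsModularMap μ q D) :
    ContDiff ℝ 1 (energy μ a D) :=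
  (ha.isSubgradientField_gradient hD).contDiff (ha.continuous_gradient hD)

theorem weakSeqLowerSemicontinuous_energy (ha : IsMonotoneNonlinearity q a m M C)
    (hD : IsModularMap μ q D) : WeakSeqLowerSemicontinuous (energy μ a D) :=
  (ha.isSubgradientField_gradient hD).weakSeqLowerSemicontinuous

theorem tendsto_of_tendsto_gradient_sub (ha : IsMonotoneNonlinearity q a m M C)
    (hD : IsModularMap μ q D) (hstrict : ∀ x, StrictMono (a x)) (hc : 0 < c)
    (hcoercive : ∀ x t, c * |t| ^ q x ≤ a x t * t) {u : ℕ → V} {v : V}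
    (h : Tendsto (fun k => (ha.gradient hD (u k) - ha.gradient hD v) (u k - v)) atTop (𝓝 0)) :
    Tendsto u atTop (𝓝 v) := by
  set F : ℕ → X → ℝ := fun k x => (a x (D (u k) x) - a x (D v x)) * (D (u k) x - D v x)
  have hF_ae : ∀ k, (fun x => (a x (D (u k) x) - a x (D v x)) * D (u k - v) x) =ᵐ[μ] F k :=
    fun k => (hD.sub (u k) v).mono fun x hx => by simp only [F, hx]
  have hF : ∀ k, Integrable (F k) μ := fun k => by
    refine Integrable.congr ?_ (hF_ae k)
    simp only [sub_mul]
    exact (ha.integrable_mul hD _ _).sub (ha.integrable_mul hD _ _)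
  have hFlim : Tendsto (fun k => ∫ x, F k x ∂μ) atTop (𝓝 0) :=
    h.congr fun k => (ha.gradient_sub_apply hD _ _ _).trans (integral_congr_ae (hF_ae k))
  obtain ⟨B, B', hB⟩ := exists_abs_sub_rpow_le hc ha.nonneg ha.one_lt M
  have hmodular : Tendsto (fun k => ∫ x, |D (u k - v) x| ^ q x ∂μ) atTop (𝓝 0) := by
    refine tendsto_integral_zero_of_le_mul_add B hF (fun k x => ha.sub_mul_sub_nonneg x _ _)
      (fun k => hD.integrable _) (fun k x => by positivity) ((hD.integrable v).const_mul B')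
      (fun k => ?_) ?_ hFlim
    · filter_upwards [hD.sub (u k) v] with x hx
      rw [hx]
      exact hB _ _ _ _ _ (ha.le_exponent x) (ha.exponent_le x) (hcoercive x _)
        (le_trans (by positivity) (hcoercive x _)) (ha.growth x _) (ha.growth x _)
    · filter_upwards [ae_all_iff.2 fun k => hD.sub (u k) v] with x hx
      simp only [hx]
      exact (tendsto_abs_rpow_zero_iff (one_pos.trans (ha.one_lt_exponent x))).2
        (tendsto_sub_nhds_zero_iff.2
          (tendsto_of_strictMono_of_tendsto_mul_sub (hstrict x) tendsto_comap))
  exact tendsto_sub_nhds_zero_iff.1 ((hD.tendsto_zero_iff _).2 hmodular)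

theorem isTypeSPlus_gradient (ha : IsMonotoneNonlinearity q a m M C) (hD : IsModularMap μ q D)
    (hstrict : ∀ x, StrictMono (a x)) (hc : 0 < c)
    (hcoercive : ∀ x t, c * |t| ^ q x ≤ a x t * t) : IsTypeSPlus (ha.gradient hD) := by
  intro u v huv hlim
  refine ha.tendsto_of_tendsto_gradient_sub hD hstrict hc hcoercive
    (huv.tendsto_sub_apply_sub_of_limsup_le (fun k => ?_) hlim)
  rw [gradient_sub_apply]
  refine integral_nonneg_of_ae ?_
  filter_upwards [hD.sub (u k) v] with x hx
  rw [hx]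
  exact ha.sub_mul_sub_nonneg x _ _

end IsMonotoneNonlinearity

end Energy

/-! ### Differences as a modular map -/

theorem tendsto_zero_iff_of_mul_le_of_le_mul {ι : Type*} {l : Filter ι} {f g : ι → ℝ≥0∞}
    {b₀ b₁ : ℝ≥0} (hb₀ : 0 < b₀) (hlower : ∀ k, b₀ * f k ≤ g k) (hupper : ∀ k, g k ≤ b₁ * f k) :
    Tendsto f l (𝓝 0) ↔ Tendsto g l (𝓝 0) := by
  have hb₀' : (b₀ : ℝ≥0∞) ≠ 0 := ENNReal.coe_ne_zero.2 hb₀.ne'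
  refine ⟨fun hf => ?_, fun hg => ?_⟩
  · have hlim := ENNReal.Tendsto.const_mul hf (Or.inr (ENNReal.coe_ne_top (r := b₁)))
    rw [mul_zero] at hlim
    exact tendsto_of_tendsto_of_tendsto_of_le_of_le tendsto_const_nhds hlim
      (fun _ => zero_le) hupper
  · have hlim := ENNReal.Tendsto.const_mul hg (Or.inr (ENNReal.inv_ne_top.2 hb₀'))
    rw [mul_zero] at hlim
    exact tendsto_of_tendsto_of_tendsto_of_le_of_le tendsto_const_nhds hlim
      (fun _ => zero_le) fun k => (ENNReal.mul_le_iff_le_inv hb₀' ENNReal.coe_ne_top).1 (hlower k)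

section Gagliardo

variable {N : ℕ} {s : ℝ} {p : Eu N × Eu N → ℝ} {Ω : Set (Eu N)}

theorem Standing.le_expSup (h : Standing N s p Ω) (z : Eu N × Eu N) : p z ≤ expSup p :=
  le_ciSup h.bddAbove z

theorem Standing.expInf_le (h : Standing N s p Ω) (z : Eu N × Eu N) : expInf p ≤ p z :=
  ciInf_le ⟨1, Set.forall_mem_range.2 fun y => (h.one_lt y).le⟩ z

theorem gagModular_deltaTwo (h : Standing N s p Ω) :
    IsConvexModular.DeltaTwo fun u : Eu N →ₘ[volume] ℝ => gagModular s p u := by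
  refine ⟨Real.toNNReal (2 ^ expSup p), fun u => ?_⟩
  beta_reduce
  rw [gagModular_congr (AEEqFun.coeFn_smul (2 : ℝ) u)]
  unfold gagModular
  rw [← lintegral_const_mul' _ _ ENNReal.coe_ne_top]
  refine lintegral_mono fun z => ?_
  change _ ≤ ENNReal.ofReal (2 ^ expSup p) * _
  rw [← ENNReal.ofReal_mul (by positivity), ← mul_div_assoc]
  refine ENNReal.ofReal_le_ofReal (div_le_div_of_nonneg_right ?_ (by positivity))
  calc |(2 : ℝ) * u z.1 - 2 * u z.2| ^ p z = 2 ^ p z * |u z.1 - u z.2| ^ p z := by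
        rw [← mul_sub, abs_mul, abs_two, Real.mul_rpow zero_le_two (abs_nonneg _)]
    _ ≤ 2 ^ expSup p * |u z.1 - u z.2| ^ p z := by
        gcongr
        · exact one_le_two
        · exact h.le_expSup z

/-- The measure `K(x, y) dx dy`. -/
noncomputable def kernelMeasure (K : Eu N × Eu N → ℝ) : Measure (Eu N × Eu N) :=
  volume.withDensity fun z => ENNReal.ofReal (K z)

theorem integrable_kernelMeasure {K : Eu N × Eu N → ℝ} (hK : Measurable K) (hK0 : ∀ z, 0 ≤ K z)
    {g : Eu N × Eu N → ℝ} : Integrable g (kernelMeasure K) ↔ Integrable fun z => g z * K z := by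
  unfold kernelMeasure
  rw [integrable_withDensity_iff hK.ennreal_ofReal (ae_of_all _ fun _ => ENNReal.ofReal_lt_top)]
  simp only [ENNReal.toReal_ofReal (hK0 _)]

theorem integral_kernelMeasure {K : Eu N × Eu N → ℝ} (hK : Measurable K) (hK0 : ∀ z, 0 ≤ K z)
    (g : Eu N × Eu N → ℝ) : ∫ z, g z ∂kernelMeasure K = ∫ z, g z * K z := by
  unfold kernelMeasure
  rw [integral_withDensity_eq_integral_toReal_smul hK.ennreal_ofReal
    (ae_of_all _ fun _ => ENNReal.ofReal_lt_top)]
  simp only [ENNReal.toReal_ofReal (hK0 _), smul_eq_mul, mul_comm (K _)]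

theorem ae_kernelMeasure {K : Eu N × Eu N → ℝ} {Q : Eu N × Eu N → Prop} (hQ : ∀ᵐ z, Q z) :
    ∀ᵐ z ∂kernelMeasure K, Q z :=
  (withDensity_absolutelyContinuous _ _).ae_le hQ

namespace W

variable {h : Standing N s p Ω} {K : Eu N × Eu N → ℝ}

theorem gagModular_lt_top (u : W h) : gagModular s p u < ∞ :=
  (gagModular_deltaTwo h).lt_top (gagModular_isConvexModular h) u.memW.gag

theorem exists_gagModular_le_of_norm_le_one (h : Standing N s p Ω) :
    ∃ B : ℝ≥0, ∀ u : W h, ‖u‖ ≤ 1 → gagModular s p u ≤ B := by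
  obtain ⟨B, hB⟩ := (gagModular_deltaTwo h).exists_le_of_lux_le_one (gagModular_isConvexModular h)
  refine ⟨B, fun u hu => hB u.toClass u.memW.gag ?_⟩
  rwa [← norm_eq_lux]

theorem tendsto_zero_iff_gagModular (u : ℕ → W h) :
    Tendsto u atTop (𝓝 0) ↔ Tendsto (fun k => gagModular s p (u k)) atTop (𝓝 0) := by
  rw [tendsto_zero_iff_norm_tendsto_zero]
  simp only [norm_eq_lux]
  exact (gagModular_deltaTwo h).tendsto_lux_zero_iff (gagModular_isConvexModular h)
    fun k => (u k).memW.gag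

/-- The difference `u(x) - u(y)`, as a function of `z = (x, y)`. -/
noncomputable def diff (u : W h) (z : Eu N × Eu N) : ℝ := u z.1 - u z.2

theorem measurable_diff (u : W h) : Measurable u.diff :=
  have hu : Measurable u := u.toClass.stronglyMeasurable.measurable
  (hu.comp measurable_fst).sub (hu.comp measurable_snd)

theorem diff_add (u v : W h) : ∀ᵐ z, (u + v).diff z = u.diff z + v.diff z := by
  filter_upwards [ae_fst_snd (AEEqFun.coeFn_add u.toClass v.toClass)] with z hz
  change (u.toClass + v.toClass) z.1 - (u.toClass + v.toClass) z.2 =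
    u.toClass z.1 - u.toClass z.2 + (v.toClass z.1 - v.toClass z.2)
  rw [hz.1, hz.2, Pi.add_apply, Pi.add_apply, add_sub_add_comm]

theorem diff_smul (c : ℝ) (u : W h) : ∀ᵐ z, (c • u).diff z = c * u.diff z := by
  filter_upwards [ae_fst_snd (AEEqFun.coeFn_smul c u.toClass)] with z hz
  change (c • u.toClass) z.1 - (c • u.toClass) z.2 = c * (u.toClass z.1 - u.toClass z.2)
  rw [hz.1, hz.2, Pi.smul_apply, Pi.smul_apply, smul_eq_mul, smul_eq_mul, mul_sub]

theorem diff_rpow_mul_bounds {b₀ b₁ : ℝ}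
    (hb : ∀ x y : Eu N, x ≠ y → b₀ ≤ K (x, y) * ‖x - y‖ ^ ((N : ℝ) + s * p (x, y)) ∧
      K (x, y) * ‖x - y‖ ^ ((N : ℝ) + s * p (x, y)) ≤ b₁) (u : W h) (z : Eu N × Eu N) :
    b₀ * (|u z.1 - u z.2| ^ p z / ‖z.1 - z.2‖ ^ ((N : ℝ) + s * p z)) ≤ K z * |u.diff z| ^ p z ∧
      K z * |u.diff z| ^ p z ≤
        b₁ * (|u z.1 - u z.2| ^ p z / ‖z.1 - z.2‖ ^ ((N : ℝ) + s * p z)) := by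
  obtain ⟨x, y⟩ := z
  rcases eq_or_ne x y with rfl | hxy
  · have hp : p (x, x) ≠ 0 := (one_pos.trans (h.one_lt _)).ne'
    simp [diff, Real.zero_rpow hp]
  · have hpow : 0 < ‖x - y‖ ^ ((N : ℝ) + s * p (x, y)) :=
      Real.rpow_pos_of_pos (norm_pos_iff.2 (sub_ne_zero.2 hxy)) _
    have hfactor : K (x, y) * |u.diff (x, y)| ^ p (x, y) =
        K (x, y) * ‖x - y‖ ^ ((N : ℝ) + s * p (x, y)) *
          (|u x - u y| ^ p (x, y) / ‖x - y‖ ^ ((N : ℝ) + s * p (x, y))) := by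
      unfold diff
      field_simp
    rw [hfactor]
    exact ⟨mul_le_mul_of_nonneg_right (hb x y hxy).1 (by positivity),
      mul_le_mul_of_nonneg_right (hb x y hxy).2 (by positivity)⟩

theorem measurable_abs_diff_rpow (u : W h) : Measurable fun z => |u.diff z| ^ p z :=
  u.measurable_diff.abs.pow h.cont.measurable

theorem exists_gagModular_le_lintegral_le (hK : KernelCond s p K) :
    ∃ b₀ b₁ : ℝ≥0, 0 < b₀ ∧ ∀ u : W h,
      b₀ * gagModular s p u ≤ ∫⁻ z, ENNReal.ofReal (|u.diff z| ^ p z) ∂kernelMeasure K ∧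
      ∫⁻ z, ENNReal.ofReal (|u.diff z| ^ p z) ∂kernelMeasure K ≤ b₁ * gagModular s p u := by
  obtain ⟨b₀, b₁, hb₀, hb₁, hb⟩ := hK.bounds
  refine ⟨b₀.toNNReal, b₁.toNNReal, Real.toNNReal_pos.2 hb₀, fun u => ?_⟩
  have hL : ∫⁻ z, ENNReal.ofReal (|u.diff z| ^ p z) ∂kernelMeasure K =
      ∫⁻ z, ENNReal.ofReal (K z * |u.diff z| ^ p z) := by
    unfold kernelMeasure
    rw [lintegral_withDensity_eq_lintegral_mul _ hK.measurable.ennreal_ofReal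
      u.measurable_abs_diff_rpow.ennreal_ofReal]
    simp only [Pi.mul_apply, ENNReal.ofReal_mul (hK.nonneg _)]
  change ENNReal.ofReal b₀ * _ ≤ _ ∧ _ ≤ ENNReal.ofReal b₁ * _
  rw [hL, gagModular, ← lintegral_const_mul' _ _ ENNReal.ofReal_ne_top,
    ← lintegral_const_mul' _ _ ENNReal.ofReal_ne_top]
  simp only [← ENNReal.ofReal_mul hb₀.le, ← ENNReal.ofReal_mul (hb₀.le.trans hb₁)]
  exact ⟨lintegral_mono fun z => ENNReal.ofReal_le_ofReal (u.diff_rpow_mul_bounds hb z).1,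
    lintegral_mono fun z => ENNReal.ofReal_le_ofReal (u.diff_rpow_mul_bounds hb z).2⟩

theorem integral_abs_diff_rpow (u : W h) : ∫ z, |u.diff z| ^ p z ∂kernelMeasure K =
    (∫⁻ z, ENNReal.ofReal (|u.diff z| ^ p z) ∂kernelMeasure K).toReal :=
  integral_eq_lintegral_of_nonneg_ae (ae_of_all _ fun z => by positivity)
    u.measurable_abs_diff_rpow.aestronglyMeasurable

theorem isModularMap_diff (h : Standing N s p Ω) (hK : KernelCond s p K) :
    IsModularMap (kernelMeasure K) p (diff : W h → Eu N × Eu N → ℝ) := by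
  obtain ⟨b₀, b₁, hb₀, hb⟩ := exists_gagModular_le_lintegral_le (h := h) hK
  have hfin : ∀ u : W h, ∫⁻ z, ENNReal.ofReal (|u.diff z| ^ p z) ∂kernelMeasure K < ∞ := fun u =>
    (hb u).2.trans_lt (ENNReal.mul_lt_top ENNReal.coe_lt_top u.gagModular_lt_top)
  refine ⟨measurable_diff, fun u v => ae_kernelMeasure (diff_add u v),
    fun c u => ae_kernelMeasure (diff_smul c u), fun u => ?_, ?_, fun u => ?_⟩
  · refine ⟨u.measurable_abs_diff_rpow.aestronglyMeasurable, ?_⟩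
    rw [hasFiniteIntegral_iff_ofReal (ae_of_all _ fun z => by positivity)]
    exact hfin u
  · obtain ⟨B, hB⟩ := exists_gagModular_le_of_norm_le_one h
    refine ⟨(b₁ * B : ℝ≥0), fun u hu => ?_⟩
    rw [integral_abs_diff_rpow]
    refine ENNReal.toReal_le_coe_of_le_coe ((hb u).2.trans ?_)
    rw [ENNReal.coe_mul]
    gcongr
    exact hB u hu
  · rw [tendsto_zero_iff_gagModular]
    simp only [integral_abs_diff_rpow]
    rw [← ENNReal.toReal_zero, ENNReal.tendsto_toReal_iff (fun k => (hfin _).ne)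
      ENNReal.zero_ne_top]
    exact tendsto_zero_iff_of_mul_le_of_le_mul hb₀ (fun k => (hb (u k)).1) fun k => (hb (u k)).2

end W

end Gagliardo

/-! ### The nonlinearity -/

section Nonlinearity

variable {N : ℕ} {s : ℝ} {p : Eu N × Eu N → ℝ} {Ω : Set (Eu N)} {A : Eu N × Eu N → ℝ → ℝ}

theorem primA_eq_primitive (hodd : ∀ z t, A z (-t) = -A z t) : primA A = primitive A := by
  funext z t
  unfold primA primitive
  rcases abs_choice t with ht | ht
  · rw [ht]
  · have hneg := intervalIntegral.integral_comp_neg (a := 0) (b := t) (A z)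
    simp only [hodd, neg_zero, intervalIntegral.integral_neg] at hneg
    rw [ht, intervalIntegral.integral_symm, ← hneg, neg_neg]

theorem strictMono_of_strictConvexOn_primA (hcont : ∀ z, Continuous (A z))
    (hodd : ∀ z t, A z (-t) = -A z t)
    (hconvex : ∀ z, StrictConvexOn ℝ Set.univ (primA A z)) (z : Eu N × Eu N) :
    StrictMono (A z) := by
  have hderiv : ∀ t, HasDerivAt (primA A z) (A z t) t := fun t => by
    rw [primA_eq_primitive hodd]
    exact ((hcont z).integral_hasStrictDerivAt 0 t).hasDerivAt
  have hmono := (hconvex z).strictMonoOn_deriv fun t _ => (hderiv t).differentiableAt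
  rwa [funext fun t => (hderiv t).deriv, strictMonoOn_univ] at hmono

theorem Standing.isMonotoneNonlinearity (h : Standing N s p Ω)
    (hmeas : Measurable (Function.uncurry A))
    (hcont : ∀ z, Continuous (A z)) (hmono : ∀ z, Monotone (A z)) {C : ℝ} (hC : 0 ≤ C)
    (hgrowth : ∀ z t, |A z t| ≤ C * |t| ^ (p z - 1)) :
    IsMonotoneNonlinearity p A (expInf p) (expSup p) C :=
  ⟨h.cont.measurable, h.one_lt_inf, h.expInf_le, h.le_expSup, hmeas, hcont, hmono, hgrowth, hC⟩

theorem Phi_eq_energy (h : Standing N s p Ω) (hodd : ∀ z t, A z (-t) = -A z t)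
    {K : Eu N × Eu N → ℝ} (hK : Measurable K) (hK0 : ∀ z, 0 ≤ K z) :
    Phi h A K = energy (kernelMeasure K) A W.diff := by
  funext u
  rw [energy, integral_kernelMeasure hK hK0, ← primA_eq_primitive hodd]
  rfl

end Nonlinearity

end FracVar

theorem lemma2p13_general (N : ℕ) (s : ℝ) (p : FracVar.Eu N × FracVar.Eu N → ℝ)
    (Ω : Set (FracVar.Eu N)) (h : FracVar.Standing N s p Ω)
    (A : FracVar.Eu N × FracVar.Eu N → ℝ → ℝ) (hA : Measurable (Function.uncurry A))
    (hcont : ∀ z, Continuous (A z)) (hodd : ∀ z t, A z (-t) = -A z t)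
    (hconvex : ∀ z, StrictConvexOn ℝ Set.univ (FracVar.primA A z))
    (hgrowth : ∃ c C : ℝ, 0 < c ∧ 0 < C ∧ ∀ z t,
      c * |t| ^ p z ≤ A z t * t ∧ |A z t| ≤ C * |t| ^ (p z - 1))
    (K : FracVar.Eu N × FracVar.Eu N → ℝ) (hK : FracVar.KernelCond s p K) :
    ((∀ u : FracVar.W h, Integrable fun z => FracVar.primA A z (u z.1 - u z.2) * K z) ∧
      ContDiff ℝ 1 (FracVar.Phi h A K) ∧
      ∀ u v : FracVar.W h,
        Integrable (fun z => A z (u z.1 - u z.2) * (v z.1 - v z.2) * K z) ∧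
        fderiv ℝ (FracVar.Phi h A K) u v =
          ∫ z, A z (u z.1 - u z.2) * (v z.1 - v z.2) * K z) ∧
    FracVar.WeakSeqLowerSemicontinuous (FracVar.Phi h A K) ∧
    FracVar.IsTypeSPlus (fderiv ℝ (FracVar.Phi h A K)) := by
  obtain ⟨c, C, hc, hC, hAcC⟩ := hgrowth
  have hstrict := FracVar.strictMono_of_strictConvexOn_primA hcont hodd hconvex
  have ha := h.isMonotoneNonlinearity hA hcont (fun z => (hstrict z).monotone) hC.le
    fun z t => (hAcC z t).2
  have hD := FracVar.W.isModularMap_diff h hK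
  have hderiv : fderiv ℝ (FracVar.Phi h A K) = ha.gradient hD := by
    rw [FracVar.Phi_eq_energy h hodd hK.measurable hK.nonneg]
    exact funext fun u => (ha.hasFDerivAt_energy hD u).fderiv
  have hint := fun g => FracVar.integrable_kernelMeasure hK.measurable hK.nonneg (g := g)
  rw [hderiv, FracVar.Phi_eq_energy h hodd hK.measurable hK.nonneg,
    FracVar.primA_eq_primitive hodd]
  refine ⟨⟨fun u => (hint _).1 (ha.integrable_primitive hD u), ha.contDiff_energy hD,
      fun u v => ⟨(hint _).1 (ha.integrable_mul hD u v), ?_⟩⟩,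
    ha.weakSeqLowerSemicontinuous_energy hD,
    ha.isTypeSPlus_gradient hD hstrict hc fun z t => (hAcC z t).1⟩
  exact FracVar.integral_kernelMeasure hK.measurable hK.nonneg _

theorem lemma2p13 (N : ℕ) (s : ℝ) (p : FracVar.Eu N × FracVar.Eu N → ℝ) (Ω : Set (FracVar.Eu N))
    (h : FracVar.Standing N s p Ω)
    (A : FracVar.Eu N × FracVar.Eu N → ℝ → ℝ) (hA : FracVar.NonlinearityCond p A)
    (K : FracVar.Eu N × FracVar.Eu N → ℝ) (hK : FracVar.KernelCond s p K) :
    -- `Φ` is well defined and of class `C¹`, with the stated derivative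
    ((∀ u : FracVar.W h,
        Integrable (fun z : FracVar.Eu N × FracVar.Eu N =>
          FracVar.primA A z (u z.1 - u z.2) * K z)) ∧
      ContDiff ℝ 1 (FracVar.Phi h A K) ∧
      ∀ u v : FracVar.W h,
        Integrable (fun z : FracVar.Eu N × FracVar.Eu N =>
          A z (u z.1 - u z.2) * (v z.1 - v z.2) * K z) ∧
        fderiv ℝ (FracVar.Phi h A K) u v =
          ∫ z : FracVar.Eu N × FracVar.Eu N, A z (u z.1 - u z.2) * (v z.1 - v z.2) * K z) ∧
    -- `Φ` is weakly (sequentially) lower semicontinuous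
    (∀ (u : ℕ → FracVar.W h) (v : FracVar.W h), FracVar.WeakTendsto u v →
      (FracVar.Phi h A K v : EReal) ≤
        liminf (fun k => (FracVar.Phi h A K (u k) : EReal)) atTop) ∧
    -- `Φ'` is of type `(S₊)`
    (∀ (u : ℕ → FracVar.W h) (v : FracVar.W h), FracVar.WeakTendsto u v →
      limsup (fun k => (fderiv ℝ (FracVar.Phi h A K) (u k) (u k - v) : EReal)) atTop ≤ 0 →
      Tendsto u atTop (𝓝 v)) :=
  lemma2p13_general N s p Ω h A hA.measurable hA.continuous hA.odd hA.strictConvex hA.growth K hK
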